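/- Let $A^*$ be the operator on $L^2(0,1)\times L^2(0,1)$ (complex-valued functions) given by $$A^*(\xi,\eta)=(\xi'+\eta',\ \xi'+\eta''+\eta'),$$ with domain $$D(A^*)=\Big\{(\xi,\eta)\in H^1(0,1)\times H^2(0,1):\ \int_0^1\xi=0,\ \xi(0)=\xi(1),\ \eta(0)=\eta(1)=0\Big\}.$$ For $k\in\mathbb N$, $k\ge1$, a parabolic eigenvalue $\lambda^p_k$ is an eigenvalue of $A^*$ of the form $-(k\pi+c+id)^2$ with $c,d\in\mathbb R$, $|c|,|d|\le\pi/2$. For $k\in\mathbb Z\setminus\{0\}$, a hyperbolic eigenvalue $\lambda^h_k$ is an eigenvalue of $A^*$ of the form $-1-\alpha_1-i(2k\pi+\alpha_2)$ with $\alpha_1,\alpha_2\in\mathbb R$, $|\alpha_1|,|\alpha_2|\le\pi/2$. For an eigenvalue $\lambda\neq0$ put $\mu=-\lambda$, let $m_1,m_2,m_3$ be the roots, with multiplicity, of $m^3-\lambda m^2-2\lambda m+\lambda^2$ in any order (a permutation changes the functions below at most by a common sign), and set $$\eta_\lambda(x)=(e^{m_2}-e^{m_3})e^{m_1x}+(e^{m_3}-e^{m_1})e^{m_2x}+(e^{m_1}-e^{m_2})e^{m_3x},\qquad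 \xi_\lambda=\frac{\eta_\lambda''+\mu\,\eta_\lambda}{\mu}.$$ Put $(\xi_{\lambda^p_k},\eta_{\lambda^p_k})=(\xi_\lambda,\eta_\lambda)$ for $\lambda=\lambda^p_k$, and $(\xi_{\lambda^h_k},\eta_{\lambda^h_k})=\dfrac{1}{k\pi\,e^{\sqrt{|k\pi|}+1/\sqrt{|k|}}}\,(\xi_\lambda,\eta_\lambda)$ for $\lambda=\lambda^h_k$. For $s>0$ let $$\|\varphi\|_{\dot H^{-s}_{per}(0,1)}=\Big(\sum_{m\in\mathbb Z}(1+4\pi^2m^2)^{-s}|c_m|^2\Big)^{1/2},\qquad c_m=\int_0^1 e^{2\pi imx}\varphi(x)\,dx.$$ Then there is a constant $C>0$, independent of $k$ (and of $s$ and of the choice of the eigenvalues), such that: 1. For every $k\ge1$ and every parabolic eigenvalue $\lambda^p_k$, $$\|\xi_{\lambda^p_k}\|_{L^2(0,1)}\le Ck^{-1},\qquad \|\eta_{\lambda^p_k}\|_{L^2(0,1)}\le C,$$ $$\|\xi_{\lambda^p_k}\|_{\dot H^{-s}_{per}(0,1)}\le Ck^{-s-1}\ \ (0<s<1),\qquad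 \|\xi_{\lambda^p_k}\|_{\dot H^{-s}_{per}(0,1)}\le Ck^{-2}\ \ (s\ge1).$$ 2. For every $k\in\mathbb Z$ with $|k|\ge1$ and every hyperbolic eigenvalue $\lambda^h_k$, $$\|\xi_{\lambda^h_k}\|_{L^2(0,1)}\le C,\qquad \|\eta_{\lambda^h_k}\|_{L^2(0,1)}\le C|k|^{-1},$$ $$\|\xi_{\lambda^h_k}\|_{\dot H^{-s}_{per}(0,1)}\le C|k|^{-s}\ \ (0<s<1),\qquad \|\xi_{\lambda^h_k}\|_{\dot H^{-s}_{per}(0,1)}\le C|k|^{-1}\ \ (s\ge1).$$ -/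

import Mathlib

open MeasureTheory Set
open scoped ENNReal

noncomputable section

namespace LinNS

/-- `f` is (the continuous representative of) an element of `H¹(0,1)` and `g ∈ L²(0,1)` is its
weak derivative. -/
def HasL2Deriv (f g : ℝ → ℂ) : Prop :=
  MemLp g 2 (volume.restrict (Ioo (0 : ℝ) 1)) ∧
    ∀ x ∈ Icc (0 : ℝ) 1, f x = f 0 + ∫ t in (0 : ℝ)..x, g t

/-- `(ξ, η)` lies in the domain
`D(A*) = {(ξ, η) ∈ H¹ × H² : ∫ ξ = 0, ξ(0) = ξ(1), η(0) = η(1) = 0}` and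
`A*(ξ, η) = (ξ' + η', ξ' + η'' + η') = (f, g)` almost everywhere on `(0,1)`. -/
def AdjointMapsTo (ξ η f g : ℝ → ℂ) : Prop :=
  ∃ ξ' η' η'' : ℝ → ℂ,
    HasL2Deriv ξ ξ' ∧ HasL2Deriv η η' ∧ HasL2Deriv η' η'' ∧
    (∫ x in (0 : ℝ)..1, ξ x) = 0 ∧ ξ 0 = ξ 1 ∧ η 0 = 0 ∧ η 1 = 0 ∧
    (∀ᵐ x ∂(volume.restrict (Ioo (0 : ℝ) 1)), ξ' x + η' x = f x) ∧
    (∀ᵐ x ∂(volume.restrict (Ioo (0 : ℝ) 1)), ξ' x + (η'' x + η' x) = g x)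

/-- `lam` is an eigenvalue of `A*`. -/
def IsEigenvalue (lam : ℂ) : Prop :=
  ∃ ξ η : ℝ → ℂ, AdjointMapsTo ξ η (fun x => lam * ξ x) (fun x => lam * η x) ∧
    ∃ x ∈ Icc (0 : ℝ) 1, ξ x ≠ 0 ∨ η x ≠ 0

/-- `lam` is a parabolic eigenvalue `λᵖₖ` of `A*`, that is, an eigenvalue of the form
`-(kπ + c + i d)²` with `|c|, |d| ≤ π/2`. -/
def IsParabolicEigenvalue (k : ℕ) (lam : ℂ) : Prop :=
  IsEigenvalue lam ∧ ∃ c d : ℝ, |c| ≤ Real.pi / 2 ∧ |d| ≤ Real.pi / 2 ∧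
    lam = -((k : ℂ) * Real.pi + c + Complex.I * d) ^ 2

/-- `lam` is a hyperbolic eigenvalue `λʰₖ` of `A*`, that is, an eigenvalue of the form
`-1 - α₁ - i (2kπ + α₂)` with `|α₁|, |α₂| ≤ π/2`. -/
def IsHyperbolicEigenvalue (k : ℤ) (lam : ℂ) : Prop :=
  IsEigenvalue lam ∧ ∃ a₁ a₂ : ℝ, |a₁| ≤ Real.pi / 2 ∧ |a₂| ≤ Real.pi / 2 ∧
    lam = -1 - a₁ - Complex.I * (2 * (k : ℂ) * Real.pi + a₂)

/-- `m₁, m₂, m₃` are the three characteristic roots, with multiplicity, of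
`η''' - lam η'' - 2 lam η' + lam² η = 0`. -/
def IsCharRoots (lam m₁ m₂ m₃ : ℂ) : Prop :=
  ∀ z : ℂ, z ^ 3 - lam * z ^ 2 - 2 * lam * z + lam ^ 2 = (z - m₁) * (z - m₂) * (z - m₃)

/-- The second component of the eigenfunction. A permutation of the roots changes at most
its sign. -/
def etaFun (m₁ m₂ m₃ : ℂ) (x : ℝ) : ℂ :=
  (Complex.exp m₂ - Complex.exp m₃) * Complex.exp (m₁ * x) +
  (Complex.exp m₃ - Complex.exp m₁) * Complex.exp (m₂ * x) +
  (Complex.exp m₁ - Complex.exp m₂) * Complex.exp (m₃ * x)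

/-- The first component of the eigenfunction, `ξ = (η'' + μ η) / μ` with `μ = -lam` and `η`
as in `etaFun`. A permutation of the roots changes at most its sign. -/
def xiFun (lam m₁ m₂ m₃ : ℂ) (x : ℝ) : ℂ :=
  ((m₁ ^ 2 + -lam) / -lam) * (Complex.exp m₂ - Complex.exp m₃) * Complex.exp (m₁ * x) +
  ((m₂ ^ 2 + -lam) / -lam) * (Complex.exp m₃ - Complex.exp m₁) * Complex.exp (m₂ * x) +
  ((m₃ ^ 2 + -lam) / -lam) * (Complex.exp m₁ - Complex.exp m₂) * Complex.exp (m₃ * x)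

/-- The normalising divisor `kπ exp(√|kπ| + 1/√|k|)` of the hyperbolic eigenfunctions. -/
def hypDivisor (k : ℤ) : ℝ :=
  k * Real.pi * Real.exp (√|k * Real.pi| + 1 / √|(k : ℝ)|)

/-- The norm of `L²(0,1)`. -/
def l2Norm (φ : ℝ → ℂ) : ℝ≥0∞ := eLpNorm φ 2 (volume.restrict (Ioo (0 : ℝ) 1))

/-- The Fourier coefficient `c_m = ∫₀¹ exp(2πimx) φ(x) dx`. -/
def fourierC (φ : ℝ → ℂ) (m : ℤ) : ℂ :=
  ∫ x in (0 : ℝ)..1, Complex.exp (2 * Real.pi * Complex.I * m * x) * φ x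

/-- The norm `(∑ₘ (1 + 4π²m²)^(-s) |c_m|²)^(1/2)` of `Ḣ⁻ˢ_per(0,1)`, with values in `[0, ∞]`. -/
def negSobolevNorm (s : ℝ) (φ : ℝ → ℂ) : ℝ≥0∞ :=
  (∑' m : ℤ, ENNReal.ofReal ((1 + 4 * Real.pi ^ 2 * (m : ℝ) ^ 2) ^ (-s)) *
    ‖fourierC φ m‖ₑ ^ 2) ^ (1 / 2 : ℝ)

end LinNS

end

namespace LinNS

/-! For large `lam` one characteristic root lies within O(1) of `lam` and the other two within O(1)
of the square roots of `lam` (`IsCharRoots.rootsSplit`). On the parabolic branch Re `lam` is about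
`-‖lam‖`, so the first root is a boundary layer of L² size `‖lam‖^(-1/2)`, while the square roots
have bounded real part. On the hyperbolic branch Re `lam` is bounded, and the square roots have real
parts close to `±√|kπ|`, which is the exponent in `hypDivisor`.

In the parabolic L² bound for ξ, the coefficient of the layer carries a factor of order `lam`. It is
compensated by `exp m₂ - exp m₃ = O(1/‖lam‖)`, a consequence of the characteristic equation of the
eigenvalues (`IsEigenvalue.characteristic_eq`). In the hyperbolic case termwise bounds suffice,
since m₂ and m₃ are almost opposite and no product of exponentials exceeds a constant times `exp
√|kπ|`.

For the negative norms, the first equation reads `(ξ + η)' = lam ξ`, and the characteristic equation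
says exactly that ξ + η takes equal values at 0 and 1. Integrating by parts against the Fourier
basis gives `‖ξ‖_{-1} ≤ ‖ξ + η‖_{L²} / ‖lam‖`. Interpolation with L² covers 0 < s < 1, and
monotonicity of the weights covers s ≥ 1. Eigenvalues of modulus at most 10000 force k to be bounded
and are absorbed into the constant. -/

/-! ### Location of the characteristic roots. -/

theorem IsCharRoots.rotate {lam m₁ m₂ m₃ : ℂ} (h : IsCharRoots lam m₁ m₂ m₃) :
    IsCharRoots lam m₂ m₃ m₁ := fun z => by rw [h z]; ring

theorem IsCharRoots.eval_fst {lam m₁ m₂ m₃ : ℂ} (h : IsCharRoots lam m₁ m₂ m₃) :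
    m₁ ^ 3 - lam * m₁ ^ 2 - 2 * lam * m₁ + lam ^ 2 = 0 := by rw [h m₁]; ring

theorem IsCharRoots.prod {lam m₁ m₂ m₃ : ℂ} (h : IsCharRoots lam m₁ m₂ m₃) :
    m₁ * m₂ * m₃ = -lam ^ 2 := by linear_combination h 0

theorem IsCharRoots.sum {lam m₁ m₂ m₃ : ℂ} (h : IsCharRoots lam m₁ m₂ m₃) :
    m₁ + m₂ + m₃ = lam := by
  linear_combination (1 / 2) * h 1 + (1 / 2) * h (-1) - h 0

/-- A crude bound for the characteristic roots. -/
theorem norm_root_le {lam m : ℂ} (h : m ^ 3 - lam * m ^ 2 - 2 * lam * m + lam ^ 2 = 0) :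
    ‖m‖ ≤ 3 * ‖lam‖ + 3 := by
  by_contra! hc
  have h1 : m ^ 3 = lam * m ^ 2 + 2 * lam * m - lam ^ 2 := by linear_combination h
  have h2 : ‖m‖ ^ 3 ≤ ‖lam‖ * ‖m‖ ^ 2 + 2 * ‖lam‖ * ‖m‖ + ‖lam‖ ^ 2 := by
    calc ‖m‖ ^ 3 = ‖lam * m ^ 2 + 2 * lam * m - lam ^ 2‖ := by rw [← h1, norm_pow]
      _ ≤ ‖lam * m ^ 2‖ + ‖2 * lam * m‖ + ‖lam ^ 2‖ :=
        (norm_sub_le _ _).trans (by gcongr; exact norm_add_le _ _)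
      _ = _ := by simp
  have hl := norm_nonneg lam
  set t := ‖m‖
  set r := ‖lam‖
  have h3 : 0 < t := by linarith
  have e1 : r * t ^ 2 ≤ (t / 3) * t ^ 2 := by gcongr; linarith
  have e2 : 2 * r * t ≤ 2 * (t / 3) * t := by gcongr; linarith
  have e3 : r ^ 2 ≤ (t / 3) ^ 2 := by gcongr; linarith
  nlinarith [mul_pos h3 h3, mul_pos (mul_pos h3 h3) (by linarith : 0 < t - 3)]

/-- The asymptotic location of the characteristic roots: `m₁` is near `lam`, and `m₂`, `m₃` are
near the two square roots of `lam`. -/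
structure RootsSplit (lam m₁ m₂ m₃ : ℂ) : Prop where
  fst : ‖m₁ - lam‖ ≤ 7
  add : ‖m₂ + m₃‖ ≤ 7
  snd : ‖m₂‖ ≤ 2 * √‖lam‖
  thd : ‖m₃‖ ≤ 2 * √‖lam‖
  re_snd : |m₂.re| ≤ √((‖lam‖ + lam.re) / 2) + 15
  re_thd : |m₃.re| ≤ √((‖lam‖ + lam.re) / 2) + 15

theorem abs_re_of_sq_eq {s lam : ℂ} (h : s ^ 2 = lam) :
    |s.re| = √((‖lam‖ + lam.re) / 2) := by
  rw [← Real.sqrt_sq_eq_abs]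
  congr 1
  subst h
  rw [norm_pow, Complex.sq_norm, Complex.normSq_apply, pow_two s, Complex.mul_re]
  ring

/-- With s² = `lam`, the equation gives `‖m - s‖ ‖m + s‖ ≤ 7‖m‖ + 10 ≤ 15‖s‖`. The two factors sum
to at least `2‖s‖`, so one of them is at least `‖s‖` and the other at most 15. The threshold 10000
makes `‖s‖ ≥ 100`, which absorbs the lower-order terms. -/
theorem root_near_sqrt {lam m e q : ℂ} (hlam : 10000 ≤ ‖lam‖) (hm : m ^ 2 = e * m - q)
    (he : ‖e‖ ≤ 7) (hq : ‖q + lam‖ ≤ 10) :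
    ‖m‖ ≤ 2 * √‖lam‖ ∧ |m.re| ≤ √((‖lam‖ + lam.re) / 2) + 15 := by
  obtain ⟨s, hs⟩ := IsAlgClosed.exists_pow_nat_eq lam (n := 2) (by norm_num)
  have hsn : ‖s‖ ^ 2 = ‖lam‖ := by rw [← norm_pow, hs]
  have hsr : √‖lam‖ = ‖s‖ := by rw [← hsn, Real.sqrt_sq (norm_nonneg _)]
  have hs100 : 100 ≤ ‖s‖ := by nlinarith [norm_nonneg s]
  have hd : ‖m ^ 2 - lam‖ ≤ 7 * ‖m‖ + 10 := by
    have : m ^ 2 - lam = e * m - (q + lam) := by rw [hm]; ring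
    rw [this]
    refine (norm_sub_le _ _).trans ?_
    rw [norm_mul]
    gcongr
  have hm2 : ‖m‖ ^ 2 ≤ 7 * ‖m‖ + 10 + ‖s‖ ^ 2 := by
    have := norm_sub_norm_le (m ^ 2) lam
    rw [norm_pow] at this
    linarith
  have hb : ‖m‖ ≤ 2 * ‖s‖ := by
    by_contra! hc
    nlinarith [norm_nonneg m]
  rw [hsr]
  refine ⟨hb, ?_⟩
  rw [← abs_re_of_sq_eq hs]
  have key : ‖m - s‖ * ‖m + s‖ ≤ 15 * ‖s‖ := by
    rw [← norm_mul, show (m - s) * (m + s) = m ^ 2 - lam by rw [← hs]; ring]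
    linarith
  have hsum : 2 * ‖s‖ ≤ ‖m - s‖ + ‖m + s‖ := by
    have : ‖(m + s) - (m - s)‖ ≤ ‖m + s‖ + ‖m - s‖ := norm_sub_le _ _
    rw [show (m + s) - (m - s) = 2 * s by ring, norm_mul] at this
    simp at this
    linarith
  have hs0 : 0 < ‖s‖ := by linarith
  rcases le_total ‖s‖ ‖m + s‖ with h | h
  · have : ‖m - s‖ ≤ 15 := by
      refine le_of_mul_le_mul_right (le_trans ?_ key) hs0
      gcongr
    have h2 := (Complex.abs_re_le_norm (m - s)).trans this
    rw [Complex.sub_re] at h2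
    have := abs_sub_abs_le_abs_sub m.re s.re
    linarith
  · have h1 : ‖s‖ ≤ ‖m - s‖ := by linarith
    have : ‖m + s‖ ≤ 15 := by
      refine le_of_mul_le_mul_left (le_trans ?_ (key.trans_eq (mul_comm _ _))) hs0
      gcongr
    have h2 := (Complex.abs_re_le_norm (m + s)).trans this
    rw [Complex.add_re] at h2
    have := abs_sub_abs_le_abs_sub m.re (-s.re)
    rw [abs_neg, sub_neg_eq_add] at this
    linarith

theorem IsCharRoots.rootsSplit_of_near {lam m₁ m₂ m₃ : ℂ} (h : IsCharRoots lam m₁ m₂ m₃)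
    (hlam : 10000 ≤ ‖lam‖) (h1 : ‖m₁ - lam‖ ≤ ‖lam‖ / 4) : RootsSplit lam m₁ m₂ m₃ := by
  have hlo : 3 / 4 * ‖lam‖ ≤ ‖m₁‖ := by
    have := norm_sub_norm_le lam m₁
    rw [norm_sub_rev] at this
    linarith
  have hhi : ‖m₁‖ ≤ 5 / 4 * ‖lam‖ := by
    have := norm_sub_norm_le m₁ lam
    linarith
  have hr : 0 < ‖lam‖ := by linarith
  have hf : ‖m₁ - lam‖ ≤ 7 := by
    -- Dividing by `‖m₁‖² ≥ (9/16)‖lam‖²` leaves (7/2)/(9/16) < 7.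
    have e : m₁ ^ 2 * (m₁ - lam) = 2 * lam * m₁ - lam ^ 2 := by linear_combination h.eval_fst
    have : ‖m₁‖ ^ 2 * ‖m₁ - lam‖ ≤ 2 * ‖lam‖ * ‖m₁‖ + ‖lam‖ ^ 2 := by
      rw [← norm_pow, ← norm_mul, e]
      refine (norm_sub_le _ _).trans_eq ?_
      simp
    have h2 : (3 / 4 * ‖lam‖) ^ 2 * ‖m₁ - lam‖ ≤ ‖m₁‖ ^ 2 * ‖m₁ - lam‖ := by gcongr
    have h3 : 2 * ‖lam‖ * ‖m₁‖ ≤ 2 * ‖lam‖ * (5 / 4 * ‖lam‖) := by gcongr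
    refine le_of_mul_le_mul_left (a := ‖lam‖ ^ 2) ?_ (by positivity)
    nlinarith
  have hadd : m₂ + m₃ = -(m₁ - lam) := by linear_combination h.sum
  have ha : ‖m₂ + m₃‖ ≤ 7 := by rwa [hadd, norm_neg]
  have hq : ‖m₂ * m₃ + lam‖ ≤ 10 := by
    have e : m₁ * (m₂ * m₃ + lam) = lam * (m₁ - lam) := by linear_combination h.prod
    have : ‖m₁‖ * ‖m₂ * m₃ + lam‖ ≤ ‖lam‖ * 7 := by
      rw [← norm_mul, e, norm_mul]; gcongr
    have h2 : (3 / 4 * ‖lam‖) * ‖m₂ * m₃ + lam‖ ≤ ‖m₁‖ * ‖m₂ * m₃ + lam‖ := by gcongr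
    refine le_of_mul_le_mul_left (a := ‖lam‖) ?_ hr
    nlinarith
  have A := root_near_sqrt hlam (m := m₂) (e := m₂ + m₃) (q := m₂ * m₃) (by ring) ha hq
  have B := root_near_sqrt hlam (m := m₃) (e := m₂ + m₃) (q := m₂ * m₃) (by ring) ha hq
  exact ⟨hf, ha, A.1, B.1, A.2, B.2⟩

theorem IsCharRoots.rootsSplit {lam m₁ m₂ m₃ : ℂ} (h : IsCharRoots lam m₁ m₂ m₃)
    (hlam : 10000 ≤ ‖lam‖) :
    RootsSplit lam m₁ m₂ m₃ ∨ RootsSplit lam m₂ m₃ m₁ ∨ RootsSplit lam m₃ m₁ m₂ := by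
  -- The characteristic polynomial takes the value `-lam²` at `lam`. If all three distances exceeded
  -- `‖lam‖/4`, their product would be cubic in `‖lam‖`, which is impossible for large `‖lam‖`.
  have key : ‖m₁ - lam‖ * ‖m₂ - lam‖ * ‖m₃ - lam‖ = ‖lam‖ ^ 2 := by
    rw [← norm_mul, ← norm_mul, ← norm_pow]
    congr 1
    linear_combination h lam
  by_contra! hc
  obtain ⟨c1, c2, c3⟩ := hc
  have d1 : ‖lam‖ / 4 < ‖m₁ - lam‖ := by
    by_contra! hh; exact c1 (h.rootsSplit_of_near hlam hh)
  have d2 : ‖lam‖ / 4 < ‖m₂ - lam‖ := by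
    by_contra! hh; exact c2 (h.rotate.rootsSplit_of_near hlam hh)
  have d3 : ‖lam‖ / 4 < ‖m₃ - lam‖ := by
    by_contra! hh; exact c3 (h.rotate.rotate.rootsSplit_of_near hlam hh)
  have hr : 0 < ‖lam‖ := by linarith
  have : ‖lam‖ / 4 * (‖lam‖ / 4) * (‖lam‖ / 4) < ‖m₁ - lam‖ * ‖m₂ - lam‖ * ‖m₃ - lam‖ := by
    gcongr
  rw [key] at this
  nlinarith [mul_pos hr hr]

/-! ### The eigenvalue system and its characteristic equation. -/

theorem HasL2Deriv.intervalIntegrable {f g : ℝ → ℂ} (h : HasL2Deriv f g) :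
    IntervalIntegrable g volume 0 1 := by
  rw [intervalIntegrable_iff_integrableOn_Ioo_of_le zero_le_one]
  exact h.1.integrable (by norm_num)

theorem HasL2Deriv.continuousOn {f g : ℝ → ℂ} (h : HasL2Deriv f g) :
    ContinuousOn f (Icc 0 1) := by
  have h1 : ContinuousOn (fun x => ∫ t in (0 : ℝ)..x, g t) (Icc 0 1) := by
    have := intervalIntegral.continuousOn_primitive_interval (a := 0) (b := 1) (f := g)
      (μ := volume) (by
        rw [uIcc_of_le zero_le_one, integrableOn_Icc_iff_integrableOn_Ioo]
        exact h.1.integrable (by norm_num))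
    rwa [uIcc_of_le zero_le_one] at this
  exact (continuousOn_const.add h1).congr h.2

theorem eq_exp_mul_of_integral_eq {u : ℝ → ℂ} {m : ℂ} (hu : ContinuousOn u (Icc 0 1))
    (h : ∀ x ∈ Icc (0 : ℝ) 1, u x = u 0 + ∫ t in (0 : ℝ)..x, m * u t) :
    ∀ x ∈ Icc (0 : ℝ) 1, u x = Complex.exp (m * x) * u 0 := by
  have hd : ∀ x ∈ Ico (0 : ℝ) 1, HasDerivWithinAt u (m * u x) (Ici x) x := by
    intro x hx
    have hmem : x ∈ Icc (0 : ℝ) 1 := Ico_subset_Icc_self hx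
    have hc : ContinuousOn (fun t => m * u t) (Icc 0 1) := continuousOn_const.mul hu
    have hi : IntervalIntegrable (fun t => m * u t) volume 0 x :=
      (hc.mono (by rw [uIcc_of_le hx.1]; exact Icc_subset_Icc_right hx.2.le)).intervalIntegrable
    have hnhds : Icc (0 : ℝ) 1 ∈ nhdsWithin x (Ioi x) :=
      Icc_mem_nhdsGT_of_mem hx
    have hint := intervalIntegral.integral_hasDerivWithinAt_right (s := Ici x) (t := Ioi x) hi
      ⟨Icc 0 1, hnhds, hc.aestronglyMeasurable measurableSet_Icc⟩
      ((hc x hmem).mono_of_mem_nhdsWithin hnhds)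
    have := hint.const_add (u 0)
    refine this.congr_of_eventuallyEq ?_ (h x hmem)
    filter_upwards [Icc_mem_nhdsGE_of_mem hx] with y hy using h y hy
  have hE : ∀ x : ℝ, HasDerivAt (fun y : ℝ => Complex.exp (-m * y))
      (Complex.exp (-m * x) * (-m)) x := by
    intro x
    have := ((Complex.ofRealCLM.hasDerivAt (x := x)).const_mul (-m)).cexp
    simpa using this
  have hconst := constant_of_has_deriv_right_zero (a := 0) (b := 1)
    (f := fun y : ℝ => Complex.exp (-m * y) * u y)
    ((by fun_prop : Continuous fun y : ℝ => Complex.exp (-m * y)).continuousOn.mul hu)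
    (fun x hx => by
      have := (hE x).hasDerivWithinAt.mul (hd x hx)
      refine this.congr_deriv ?_
      ring)
  intro x hx
  have h0 := hconst x hx
  simp only [Complex.ofReal_zero, mul_zero, Complex.exp_zero, one_mul] at h0
  rw [← h0, ← mul_assoc, ← Complex.exp_add]
  simp

/-- The linear forms diagonalising the eigenvalue system. -/
theorem diagonal_form {lam m : ℂ} (hm : m ^ 3 - lam * m ^ 2 - 2 * lam * m + lam ^ 2 = 0)
    {ξ η ξ' η' η'' : ℝ → ℂ} (h1 : HasL2Deriv ξ ξ') (h2 : HasL2Deriv η η')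
    (h3 : HasL2Deriv η' η'')
    (e1 : ∀ᵐ x ∂(volume.restrict (Ioo (0 : ℝ) 1)), ξ' x + η' x = lam * ξ x)
    (e2 : ∀ᵐ x ∂(volume.restrict (Ioo (0 : ℝ) 1)), ξ' x + (η'' x + η' x) = lam * η x) :
    ∀ x ∈ Icc (0 : ℝ) 1, (lam - m ^ 2) * ξ x + lam * η x + m * η' x =
      Complex.exp (m * x) * ((lam - m ^ 2) * ξ 0 + lam * η 0 + m * η' 0) := by
  refine eq_exp_mul_of_integral_eq
    (u := fun x => (lam - m ^ 2) * ξ x + lam * η x + m * η' x) ?_ ?_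
  · exact ((continuousOn_const.mul h1.continuousOn).add
      (continuousOn_const.mul h2.continuousOn)).add (continuousOn_const.mul h3.continuousOn)
  · intro x hx
    have hsub : uIcc 0 x ⊆ uIcc (0 : ℝ) 1 := by
      rw [uIcc_of_le hx.1, uIcc_of_le zero_le_one]; exact Icc_subset_Icc_right hx.2
    have i1 := h1.intervalIntegrable.mono_set hsub
    have i2 := h2.intervalIntegrable.mono_set hsub
    have i3 := h3.intervalIntegrable.mono_set hsub
    have hI : ∫ t in (0 : ℝ)..x, m * ((lam - m ^ 2) * ξ t + lam * η t + m * η' t) =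
        ∫ t in (0 : ℝ)..x, ((lam - m ^ 2) * ξ' t + lam * η' t + m * η'' t) := by
      have hmono : volume.restrict (Ioo 0 x) ≤ volume.restrict (Ioo (0 : ℝ) 1) :=
        Measure.restrict_mono (Ioo_subset_Ioo_right hx.2) le_rfl
      rw [intervalIntegral.integral_of_le hx.1, intervalIntegral.integral_of_le hx.1,
        integral_Ioc_eq_integral_Ioo, integral_Ioc_eq_integral_Ioo]
      refine integral_congr_ae ?_
      filter_upwards [ae_mono hmono e1, ae_mono hmono e2] with t ht1 ht2
      have hξ' : ξ' t = lam * ξ t - η' t := by linear_combination ht1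
      have hη'' : η'' t = lam * η t - lam * ξ t := by linear_combination ht2 - ht1
      rw [hξ', hη'']
      by_cases hl : lam = 0
      · subst hl
        have : m = 0 := by simpa using hm
        simp [this]
      -- The row `(lam - m², lam, m)` is a left eigenvector, with eigenvalue m, of the first-order
      -- system for (ξ, η, η').
      · linear_combination (-ξ t) * hm
    rw [hI, intervalIntegral.integral_add ((i1.const_mul _).add (i2.const_mul _))
      (i3.const_mul _), intervalIntegral.integral_add (i1.const_mul _) (i2.const_mul _)]
    simp only [intervalIntegral.integral_const_mul]
    have a1 := h1.2 x hx
    have a2 := h2.2 x hx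
    have a3 := h3.2 x hx
    rw [a1, a2, a3]
    ring

theorem eq_zero_of_linear_forms {lam m₁ m₂ m₃ a b c : ℂ} (hlam : lam ≠ 0) (h12 : m₁ ≠ m₂)
    (h13 : m₁ ≠ m₃) (h23 : m₂ ≠ m₃) (e1 : (lam - m₁ ^ 2) * a + lam * b + m₁ * c = 0)
    (e2 : (lam - m₂ ^ 2) * a + lam * b + m₂ * c = 0)
    (e3 : (lam - m₃ ^ 2) * a + lam * b + m₃ * c = 0) : a = 0 ∧ b = 0 := by
  have f12 : c - (m₁ + m₂) * a = 0 := by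
    refine (mul_eq_zero.mp ?_).resolve_left (sub_ne_zero.mpr h12)
    linear_combination e1 - e2
  have f13 : c - (m₁ + m₃) * a = 0 := by
    refine (mul_eq_zero.mp ?_).resolve_left (sub_ne_zero.mpr h13)
    linear_combination e1 - e3
  have ha : a = 0 := by
    refine (mul_eq_zero.mp ?_).resolve_left (sub_ne_zero.mpr h23)
    linear_combination f13 - f12
  subst ha
  have hc : c = 0 := by linear_combination f12
  subst hc
  refine ⟨rfl, (mul_eq_zero.mp ?_).resolve_left hlam⟩
  linear_combination e1

/-- The characteristic equation of the eigenvalues. -/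
theorem IsEigenvalue.characteristic_eq {lam m₁ m₂ m₃ : ℂ} (h : IsEigenvalue lam)
    (hlam : lam ≠ 0) (hm : IsCharRoots lam m₁ m₂ m₃) :
    m₁ ^ 2 * (1 - Complex.exp m₁) * (Complex.exp m₂ - Complex.exp m₃) +
    m₂ ^ 2 * (1 - Complex.exp m₂) * (Complex.exp m₃ - Complex.exp m₁) +
    m₃ ^ 2 * (1 - Complex.exp m₃) * (Complex.exp m₁ - Complex.exp m₂) = 0 := by
  by_cases h12 : m₁ = m₂
  · subst h12; ring
  by_cases h13 : m₁ = m₃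
  · subst h13; ring
  by_cases h23 : m₂ = m₃
  · subst h23; ring
  obtain ⟨ξ, η, ⟨ξ', η', η'', H1, H2, H3, -, hξ, hη0, hη1, e1, e2⟩, x, hx, hne⟩ := h
  have D1 := diagonal_form hm.eval_fst H1 H2 H3 e1 e2
  have D2 := diagonal_form hm.rotate.eval_fst H1 H2 H3 e1 e2
  have D3 := diagonal_form hm.rotate.rotate.eval_fst H1 H2 H3 e1 e2
  have E1 := D1 1 (by simp)
  have E2 := D2 1 (by simp)
  have E3 := D3 1 (by simp)
  simp only [Complex.ofReal_one, mul_one, hη0, hη1, ← hξ] at E1 E2 E3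
  -- The cubic gives `lam (lam - m²) = m (2 lam - m²)`. After multiplication by `lam` a factor m
  -- therefore cancels, and η'(0), η'(1) keep coefficients from which the differences of
  -- exponentials eliminate them.
  have reduce : ∀ m : ℂ, m ^ 3 - lam * m ^ 2 - 2 * lam * m + lam ^ 2 = 0 →
      (lam - m ^ 2) * ξ 0 + lam * 0 + m * η' 1 =
        Complex.exp m * ((lam - m ^ 2) * ξ 0 + lam * 0 + m * η' 0) →
      (2 * lam - m ^ 2) * (1 - Complex.exp m) * ξ 0 + lam * η' 1
        - lam * Complex.exp m * η' 0 = 0 := by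
    intro m hm' hE
    have hm0 : m ≠ 0 := by
      rintro rfl
      apply hlam
      simpa using hm'
    refine (mul_eq_zero.mp ?_).resolve_left hm0
    linear_combination lam * hE - (1 - Complex.exp m) * ξ 0 * hm'
  have R1 := reduce m₁ hm.eval_fst E1
  have R2 := reduce m₂ hm.rotate.eval_fst E2
  have R3 := reduce m₃ hm.rotate.rotate.eval_fst E3
  by_cases hx0 : ξ 0 = 0
  · rw [hx0] at R1 R2 R3
    by_cases hp : η' 0 = 0
    · exfalso
      -- All data at 0 vanish, so the three forms vanish at every x, contradicting that the
      -- eigenfunction is nonzero.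
      have z := eq_zero_of_linear_forms (a := ξ x) (b := η x) (c := η' x) hlam h12 h13 h23
        (by rw [D1 x hx, hx0, hη0, hp]; ring) (by rw [D2 x hx, hx0, hη0, hp]; ring)
        (by rw [D3 x hx, hx0, hη0, hp]; ring)
      rcases hne with hne | hne
      · exact hne z.1
      · exact hne z.2
    · have hlp : lam * η' 0 ≠ 0 := mul_ne_zero hlam hp
      have q12 : Complex.exp m₁ = Complex.exp m₂ :=
        mul_left_cancel₀ hlp (by linear_combination R2 - R1)
      have q13 : Complex.exp m₁ = Complex.exp m₃ :=
        mul_left_cancel₀ hlp (by linear_combination R3 - R1)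
      rw [← q12, ← q13]; ring
  · refine (mul_eq_zero.mp ?_).resolve_left hx0
    -- These multipliers are the cofactors eliminating η'(0) and η'(1). The `2 lam` contributions
    -- cancel identically in the cyclic sum.
    linear_combination -(Complex.exp m₂ - Complex.exp m₃) * R1
      - (Complex.exp m₃ - Complex.exp m₁) * R2 - (Complex.exp m₁ - Complex.exp m₂) * R3

/-! ### L² and negative Sobolev norms. -/

theorem l2Norm_le_of_forall_norm_le {φ : ℝ → ℂ} {a : ℝ}
    (h : ∀ x ∈ Icc (0 : ℝ) 1, ‖φ x‖ ≤ a) : l2Norm φ ≤ ENNReal.ofReal a := by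
  have := eLpNorm_le_of_ae_bound (p := 2) (μ := volume.restrict (Ioo (0 : ℝ) 1)) (f := φ) (C := a)
    ((ae_restrict_iff' measurableSet_Ioo).mpr
      (Filter.Eventually.of_forall fun x hx => h x (Ioo_subset_Icc_self hx)))
  simpa [l2Norm] using this

theorem l2Norm_add_le {φ ψ : ℝ → ℂ} (hφ : Continuous φ) (hψ : Continuous ψ) :
    l2Norm (fun x => φ x + ψ x) ≤ l2Norm φ + l2Norm ψ :=
  eLpNorm_add_le hφ.aestronglyMeasurable hψ.aestronglyMeasurable (by norm_num)

theorem sq_l2Norm_eq {φ : ℝ → ℂ} (hφ : Continuous φ) :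
    l2Norm φ ^ 2 = ENNReal.ofReal (∫ x in (0 : ℝ)..1, ‖φ x‖ ^ 2) := by
  have hi : Integrable (fun x => ‖φ x‖ ^ 2) (volume.restrict (Ioo (0 : ℝ) 1)) :=
    ((hφ.norm.pow 2).continuousOn.integrableOn_Icc (a := 0) (b := 1)).mono_set
      Ioo_subset_Icc_self
  rw [intervalIntegral.integral_of_le zero_le_one, integral_Ioc_eq_integral_Ioo,
    ofReal_integral_eq_lintegral_ofReal hi (Filter.Eventually.of_forall fun x => by positivity),
    l2Norm, eLpNorm_eq_lintegral_rpow_enorm_toReal (by norm_num) (by norm_num)]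
  rw [← ENNReal.rpow_natCast, ← ENNReal.rpow_mul]
  norm_num

theorem fourierC_eq_fourierCoeffOn (φ : ℝ → ℂ) (m : ℤ) :
    fourierC φ m = fourierCoeffOn (zero_lt_one' ℝ) φ (-m) := by
  rw [fourierCoeffOn_eq_integral]
  simp only [fourierC, sub_zero, ne_eq, one_ne_zero, not_false_eq_true, div_self, one_smul, neg_neg,
    smul_eq_mul]
  refine intervalIntegral.integral_congr fun x _ => ?_
  simp only [fourier_coe_apply]
  norm_num

theorem tsum_sq_fourierC {φ : ℝ → ℂ} (hφ : Continuous φ) :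
    ∑' m : ℤ, ‖fourierC φ m‖ₑ ^ 2 = l2Norm φ ^ 2 := by
  have hL : MemLp φ 2 (volume.restrict (Ioc (0 : ℝ) 1)) := by
    obtain ⟨K, hK⟩ := (isCompact_Icc (a := (0 : ℝ)) (b := 1)).exists_bound_of_continuousOn
      hφ.continuousOn
    exact MemLp.of_bound hφ.aestronglyMeasurable K ((ae_restrict_iff' measurableSet_Ioc).mpr
      (Filter.Eventually.of_forall fun x hx => hK x (Ioc_subset_Icc_self hx)))
  have h := hasSum_sq_fourierCoeffOn (zero_lt_one' ℝ) hL
  rw [sq_l2Norm_eq hφ]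
  have h2 : ∑' m : ℤ, ‖fourierC φ m‖ₑ ^ 2 =
      ∑' m : ℤ, ‖fourierCoeffOn (zero_lt_one' ℝ) φ m‖ₑ ^ 2 := by
    simp only [fourierC_eq_fourierCoeffOn]
    exact (Equiv.neg ℤ).tsum_eq (fun m => ‖fourierCoeffOn (zero_lt_one' ℝ) φ m‖ₑ ^ 2)
  rw [h2]
  have h3 := h.tsum_eq
  simp only [sub_zero, inv_one, one_smul] at h3
  rw [← h3, ENNReal.ofReal_tsum_of_nonneg (fun _ => by positivity) h.summable]
  refine tsum_congr fun m => ?_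
  rw [ENNReal.ofReal_pow (norm_nonneg _), ofReal_norm]

theorem negSobolevNorm_le {s b : ℝ} {φ : ℝ → ℂ}
    (h : ∑' m : ℤ, ENNReal.ofReal ((1 + 4 * Real.pi ^ 2 * (m : ℝ) ^ 2) ^ (-s)) *
      ‖fourierC φ m‖ₑ ^ 2 ≤ ENNReal.ofReal b ^ 2) :
    negSobolevNorm s φ ≤ ENNReal.ofReal b := by
  refine (ENNReal.rpow_le_rpow h (by norm_num)).trans_eq ?_
  rw [← ENNReal.rpow_natCast, ← ENNReal.rpow_mul]
  norm_num

theorem sq_negSobolevNorm (s : ℝ) (φ : ℝ → ℂ) :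
    negSobolevNorm s φ ^ 2 = ∑' m : ℤ,
      ENNReal.ofReal ((1 + 4 * Real.pi ^ 2 * (m : ℝ) ^ 2) ^ (-s)) * ‖fourierC φ m‖ₑ ^ 2 := by
  rw [negSobolevNorm, ← ENNReal.rpow_natCast, ← ENNReal.rpow_mul]
  norm_num

theorem one_le_weight (m : ℤ) : 1 ≤ 1 + 4 * Real.pi ^ 2 * (m : ℝ) ^ 2 := by
  have : 0 ≤ 4 * Real.pi ^ 2 * (m : ℝ) ^ 2 := by positivity
  linarith

theorem negSobolevNorm_anti {s t : ℝ} (h : s ≤ t) (φ : ℝ → ℂ) :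
    negSobolevNorm t φ ≤ negSobolevNorm s φ := by
  refine ENNReal.rpow_le_rpow (ENNReal.tsum_le_tsum fun m => ?_) (by norm_num)
  gcongr
  exact one_le_weight m

theorem negSobolevNorm_le_l2Norm {s : ℝ} (hs : 0 ≤ s) {φ : ℝ → ℂ} (hφ : Continuous φ) :
    negSobolevNorm s φ ≤ l2Norm φ := by
  refine (negSobolevNorm_anti hs φ).trans_eq ?_
  have h := tsum_sq_fourierC hφ
  simp only [negSobolevNorm, neg_zero, Real.rpow_zero, ENNReal.ofReal_one, one_mul]
  rw [h, ← ENNReal.rpow_natCast, ← ENNReal.rpow_mul]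
  norm_num

/-- Interpolation between `L²` and `Ḣ⁻¹`. -/
theorem negSobolevNorm_interpolation {φ : ℝ → ℂ} (hφ : Continuous φ) {a κ s : ℝ} (ha : 0 ≤ a)
    (hκ : 0 < κ) (h0 : l2Norm φ ≤ ENNReal.ofReal a)
    (h1 : negSobolevNorm 1 φ ≤ ENNReal.ofReal (a * κ⁻¹)) (hs0 : 0 ≤ s) (hs1 : s ≤ 1) :
    negSobolevNorm s φ ≤ ENNReal.ofReal (2 * a * κ ^ (-s)) := by
  refine negSobolevNorm_le ?_
  have hw : ∀ m : ℤ, (1 + 4 * Real.pi ^ 2 * (m : ℝ) ^ 2) ^ (-s) ≤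
      (κ ^ (-s)) ^ 2 * (1 + κ ^ 2 * (1 + 4 * Real.pi ^ 2 * (m : ℝ) ^ 2) ^ (-1 : ℝ)) := by
    intro m
    have hm : 0 < 1 + 4 * Real.pi ^ 2 * (m : ℝ) ^ 2 := by linarith [one_le_weight m]
    set w := 1 + 4 * Real.pi ^ 2 * (m : ℝ) ^ 2
    have hpos : 0 < κ ^ 2 * w⁻¹ := by positivity
    have hk : (κ ^ (-s)) ^ 2 = (κ ^ 2) ^ (-s) := by
      rw [← Real.rpow_natCast, ← Real.rpow_natCast, ← Real.rpow_mul hκ.le, ← Real.rpow_mul hκ.le,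
        mul_comm]
    -- The interpolation is done weight by weight, from `y^s ≤ 1 + y` with `y = κ²/w`.
    have hy : (κ ^ 2 * w⁻¹) ^ s ≤ 1 + κ ^ 2 * w⁻¹ := by
      rcases le_total (κ ^ 2 * w⁻¹) 1 with h | h
      · have := Real.rpow_le_one hpos.le h hs0
        linarith
      · have := Real.rpow_le_rpow_of_exponent_le h hs1
        rw [Real.rpow_one] at this
        linarith
    rw [Real.rpow_neg_one, hk]
    calc w ^ (-s) = (κ ^ 2) ^ (-s) * (κ ^ 2 * w⁻¹) ^ s := by
          rw [Real.mul_rpow (by positivity) (by positivity), ← mul_assoc,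
            ← Real.rpow_add (by positivity), neg_add_cancel, Real.rpow_zero, one_mul,
            Real.inv_rpow hm.le, Real.rpow_neg hm.le]
      _ ≤ _ := by gcongr
  have hκs : 0 < κ ^ (-s) := by positivity
  calc _ ≤ ∑' m : ℤ, (ENNReal.ofReal ((κ ^ (-s)) ^ 2) * ‖fourierC φ m‖ₑ ^ 2 +
        ENNReal.ofReal ((κ ^ (-s)) ^ 2 * κ ^ 2) *
          (ENNReal.ofReal ((1 + 4 * Real.pi ^ 2 * (m : ℝ) ^ 2) ^ (-1 : ℝ)) *
            ‖fourierC φ m‖ₑ ^ 2)) := by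
        refine ENNReal.tsum_le_tsum fun m => ?_
        have hm : 0 < 1 + 4 * Real.pi ^ 2 * (m : ℝ) ^ 2 := by linarith [one_le_weight m]
        rw [← mul_assoc, ← add_mul, ← ENNReal.ofReal_mul (by positivity),
          ← ENNReal.ofReal_add (by positivity) (by positivity)]
        gcongr
        exact (hw m).trans_eq (by ring)
    _ = ENNReal.ofReal ((κ ^ (-s)) ^ 2) * l2Norm φ ^ 2 +
        ENNReal.ofReal ((κ ^ (-s)) ^ 2 * κ ^ 2) * negSobolevNorm 1 φ ^ 2 := by
        rw [ENNReal.tsum_add, ENNReal.tsum_mul_left, ENNReal.tsum_mul_left, tsum_sq_fourierC hφ,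
          sq_negSobolevNorm]
    _ ≤ ENNReal.ofReal ((κ ^ (-s)) ^ 2) * ENNReal.ofReal a ^ 2 +
        ENNReal.ofReal ((κ ^ (-s)) ^ 2 * κ ^ 2) * ENNReal.ofReal (a * κ⁻¹) ^ 2 := by gcongr
    _ = ENNReal.ofReal (2 * (κ ^ (-s)) ^ 2 * a ^ 2) := by
        rw [← ENNReal.ofReal_pow ha, ← ENNReal.ofReal_pow (by positivity),
          ← ENNReal.ofReal_mul (by positivity), ← ENNReal.ofReal_mul (by positivity),
          ← ENNReal.ofReal_add (by positivity) (by positivity)]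
        congr 1
        field_simp
        ring
    _ ≤ ENNReal.ofReal (2 * a * κ ^ (-s)) ^ 2 := by
        rw [← ENNReal.ofReal_pow (by positivity)]
        refine ENNReal.ofReal_le_ofReal ?_
        have : 0 ≤ (κ ^ (-s)) ^ 2 * a ^ 2 := by positivity
        nlinarith

theorem fourierC_deriv {φ Φ : ℝ → ℂ} {lam : ℂ} (hφ : Continuous φ)
    (hd : ∀ x, HasDerivAt Φ (lam * φ x) x) (hp : Φ 0 = Φ 1) (m : ℤ) :
    lam * fourierC φ m = -(2 * Real.pi * Complex.I * m) * fourierC Φ m := by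
  have hE : ∀ x : ℝ, HasDerivAt (fun y : ℝ => Complex.exp (2 * Real.pi * Complex.I * m * y))
      (Complex.exp (2 * Real.pi * Complex.I * m * x) * (2 * Real.pi * Complex.I * m)) x := by
    intro x
    have := ((Complex.ofRealCLM.hasDerivAt (x := x)).const_mul (2 * Real.pi * Complex.I * m)).cexp
    simpa using this
  have h := intervalIntegral.integral_mul_deriv_eq_deriv_mul (a := 0) (b := 1)
    (u := fun y : ℝ => Complex.exp (2 * Real.pi * Complex.I * m * y)) (v := Φ)
    (v' := fun x => lam * φ x) (fun x _ => hE x) (fun x _ => hd x)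
    (by apply Continuous.intervalIntegrable; fun_prop)
    (by apply Continuous.intervalIntegrable; fun_prop)
  have e1 : Complex.exp (2 * Real.pi * Complex.I * m * (1 : ℝ)) = 1 := by
    rw [Complex.ofReal_one, mul_one, mul_comm]
    exact Complex.exp_int_mul_two_pi_mul_I m
  rw [e1, hp] at h
  simp only [Complex.ofReal_zero, mul_zero, Complex.exp_zero, sub_self, zero_sub] at h
  rw [fourierC, fourierC, ← intervalIntegral.integral_const_mul,
    ← intervalIntegral.integral_const_mul]
  calc _ = ∫ x in (0 : ℝ)..1, Complex.exp (2 * Real.pi * Complex.I * m * x) * (lam * φ x) := by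
        congr 1; ext x; ring
    _ = _ := by
        rw [h, ← intervalIntegral.integral_neg]
        congr 1; ext x; ring

/-- By periodicity `‖lam‖² |c_m(φ)|² = 4π²m² |c_m(Φ)|²`, and `4π²m²` is at most the weight, so
Parseval for Φ finishes. The mode m = 0 contributes nothing. -/
theorem negSobolevNorm_one_le {φ Φ : ℝ → ℂ} {lam : ℂ} (hlam : lam ≠ 0) (hφ : Continuous φ)
    (hd : ∀ x, HasDerivAt Φ (lam * φ x) x) (hp : Φ 0 = Φ 1) {b : ℝ} (hb : 0 ≤ b)
    (h : l2Norm Φ ≤ ENNReal.ofReal b) :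
    negSobolevNorm 1 φ ≤ ENNReal.ofReal (b / ‖lam‖) := by
  have hΦ : Continuous Φ := continuous_iff_continuousAt.mpr fun x => (hd x).continuousAt
  have hl : 0 < ‖lam‖ := norm_pos_iff.mpr hlam
  refine negSobolevNorm_le ?_
  calc _ ≤ ∑' m : ℤ, ENNReal.ofReal ((‖lam‖ ^ 2)⁻¹) * ‖fourierC Φ m‖ₑ ^ 2 := by
        refine ENNReal.tsum_le_tsum fun m => ?_
        rw [← ofReal_norm, ← ofReal_norm, ← ENNReal.ofReal_pow (norm_nonneg _),
          ← ENNReal.ofReal_pow (norm_nonneg _), ← ENNReal.ofReal_mul (by positivity),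
          ← ENNReal.ofReal_mul (by positivity)]
        refine ENNReal.ofReal_le_ofReal ?_
        have hw : 0 < 1 + 4 * Real.pi ^ 2 * (m : ℝ) ^ 2 := by linarith [one_le_weight m]
        have e := congrArg (fun z : ℂ => ‖z‖ ^ 2) (fourierC_deriv hφ hd hp m)
        simp only [norm_mul, norm_neg, Complex.norm_real, Complex.norm_I, Complex.norm_ofNat,
          Complex.norm_intCast, Real.norm_eq_abs, mul_pow, sq_abs] at e
        rw [Real.rpow_neg_one, inv_mul_le_iff₀ hw, ← mul_assoc, mul_comm _ (‖lam‖ ^ 2)⁻¹,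
          mul_assoc, le_inv_mul_iff₀ (by positivity), e]
        gcongr
        nlinarith
    _ = ENNReal.ofReal ((‖lam‖ ^ 2)⁻¹) * l2Norm Φ ^ 2 := by
        rw [ENNReal.tsum_mul_left, tsum_sq_fourierC hΦ]
    _ ≤ ENNReal.ofReal ((‖lam‖ ^ 2)⁻¹) * ENNReal.ofReal b ^ 2 := by gcongr
    _ = _ := by
        rw [← ENNReal.ofReal_pow hb, ← ENNReal.ofReal_pow (by positivity),
          ← ENNReal.ofReal_mul (by positivity)]
        congr 1
        field_simp

theorem l2Norm_exp_le {m : ℂ} {r : ℝ} (hr : 0 < r) (hm : m.re ≤ -r / 2) :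
    l2Norm (fun x : ℝ => Complex.exp (m * x)) ≤ ENNReal.ofReal (1 / √r) := by
  have hc : Continuous (fun x : ℝ => Complex.exp (m * x)) := by fun_prop
  have h : l2Norm (fun x : ℝ => Complex.exp (m * x)) ^ 2 ≤ ENNReal.ofReal (1 / √r) ^ 2 := by
    rw [sq_l2Norm_eq hc, ← ENNReal.ofReal_pow (by positivity)]
    refine ENNReal.ofReal_le_ofReal ?_
    calc ∫ x in (0 : ℝ)..1, ‖Complex.exp (m * x)‖ ^ 2 ≤
        ∫ x in (0 : ℝ)..1, Real.exp (-r * x) := by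
          refine intervalIntegral.integral_mono_on zero_le_one ?_ ?_ fun x hx => ?_
          · apply Continuous.intervalIntegrable; fun_prop
          · apply Continuous.intervalIntegrable; fun_prop
          · rw [Complex.norm_exp, ← Real.exp_nat_mul]
            refine Real.exp_le_exp.mpr ?_
            simp only [Complex.re_mul_ofReal, Nat.cast_ofNat]
            nlinarith [hx.1]
      _ = (1 - Real.exp (-r)) / r := by
          rw [intervalIntegral.integral_comp_mul_left (fun x => Real.exp x) (by linarith)]
          simp
          field_simp
          ring
      _ ≤ (1 / √r) ^ 2 := by
          rw [div_pow, Real.sq_sqrt hr.le]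
          gcongr
          have := Real.exp_pos (-r)
          linarith
  rw [← ENNReal.rpow_natCast, ← ENNReal.rpow_natCast] at h
  exact (ENNReal.rpow_le_rpow_iff (by norm_num)).mp h

/-! ### The periodic primitive ξ + η. -/

theorem etaFun_rotate (m₁ m₂ m₃ : ℂ) : etaFun m₂ m₃ m₁ = etaFun m₁ m₂ m₃ := by
  ext x; simp only [etaFun]; ring

theorem xiFun_rotate (lam m₁ m₂ m₃ : ℂ) : xiFun lam m₂ m₃ m₁ = xiFun lam m₁ m₂ m₃ := by
  ext x; simp only [xiFun]; ring

theorem continuous_etaFun (m₁ m₂ m₃ : ℂ) : Continuous (etaFun m₁ m₂ m₃) := by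
  unfold etaFun; fun_prop

theorem continuous_xiFun (lam m₁ m₂ m₃ : ℂ) : Continuous (xiFun lam m₁ m₂ m₃) := by
  unfold xiFun; fun_prop

theorem hasDerivAt_cexp_mul (m : ℂ) (x : ℝ) :
    HasDerivAt (fun y : ℝ => Complex.exp (m * y)) (Complex.exp (m * x) * m) x := by
  simpa using ((Complex.ofRealCLM.hasDerivAt (x := x)).const_mul m).cexp

theorem hasDerivAt_xi_add_eta {lam m₁ m₂ m₃ : ℂ} (hlam : lam ≠ 0)
    (h : IsCharRoots lam m₁ m₂ m₃) (x : ℝ) :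
    HasDerivAt (fun x => xiFun lam m₁ m₂ m₃ x + etaFun m₁ m₂ m₃ x)
      (lam * xiFun lam m₁ m₂ m₃ x) x := by
  have E := fun (a : ℂ) (m : ℂ) => (hasDerivAt_cexp_mul m x).const_mul a
  have hξ : HasDerivAt (xiFun lam m₁ m₂ m₃) _ x := ((E _ m₁).add (E _ m₂)).add (E _ m₃)
  have hη : HasDerivAt (etaFun m₁ m₂ m₃) _ x := ((E _ m₁).add (E _ m₂)).add (E _ m₃)
  refine (hξ.add hη).congr_deriv ?_
  -- Mode by mode, with a the ξ-coefficient of `exp (m x)`, the equation `(ξ + η)' = lam ξ` becomes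
  -- `(a + 1) m = lam a`, which is the cubic.
  have key : ∀ m : ℂ, m ^ 3 - lam * m ^ 2 - 2 * lam * m + lam ^ 2 = 0 →
      (m ^ 2 + -lam) / -lam * m + m = lam * ((m ^ 2 + -lam) / -lam) := by
    intro m hm
    field_simp
    linear_combination -hm
  simp only [xiFun]
  linear_combination (Complex.exp m₂ - Complex.exp m₃) * Complex.exp (m₁ * x) * key _ h.eval_fst +
    (Complex.exp m₃ - Complex.exp m₁) * Complex.exp (m₂ * x) * key _ h.rotate.eval_fst +
    (Complex.exp m₁ - Complex.exp m₂) * Complex.exp (m₃ * x) * key _ h.rotate.rotate.eval_fst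

theorem xi_add_eta_periodic {lam m₁ m₂ m₃ : ℂ} (hlam : lam ≠ 0) (he : IsEigenvalue lam)
    (h : IsCharRoots lam m₁ m₂ m₃) :
    xiFun lam m₁ m₂ m₃ 0 + etaFun m₁ m₂ m₃ 0 = xiFun lam m₁ m₂ m₃ 1 + etaFun m₁ m₂ m₃ 1 := by
  have := he.characteristic_eq hlam h
  simp only [xiFun, etaFun, Complex.ofReal_zero, mul_zero, Complex.exp_zero, Complex.ofReal_one,
    mul_one]
  field_simp
  linear_combination -this

/-- The divisor D serves both families: 1 in the parabolic case, `hypDivisor k` in the hyperbolic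
one. -/
theorem negSobolevNorm_one_xi_le {lam m₁ m₂ m₃ D : ℂ} (hlam : lam ≠ 0) (he : IsEigenvalue lam)
    (h : IsCharRoots lam m₁ m₂ m₃) {b : ℝ} (hb : 0 ≤ b)
    (hl : l2Norm (fun x => xiFun lam m₁ m₂ m₃ x / D + etaFun m₁ m₂ m₃ x / D) ≤
      ENNReal.ofReal b) :
    negSobolevNorm 1 (fun x => xiFun lam m₁ m₂ m₃ x / D) ≤ ENNReal.ofReal (b / ‖lam‖) := by
  refine negSobolevNorm_one_le hlam ((continuous_xiFun _ _ _ _).div_const D)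
    (Φ := fun x => xiFun lam m₁ m₂ m₃ x / D + etaFun m₁ m₂ m₃ x / D) (fun x => ?_) ?_ hb hl
  · have := (hasDerivAt_xi_add_eta hlam h x).div_const D
    simp only [add_div] at this
    rwa [mul_div_assoc] at this
  · simp only [← add_div]
    rw [xi_add_eta_periodic hlam he h]

/-! ### Pointwise bounds and bounded eigenvalues. -/

theorem norm_mul_sub_mul_le {r p q z : ℂ} {A P Z : ℝ} (hr : ‖r‖ ≤ A) (hp : ‖p‖ ≤ P)
    (hq : ‖q‖ ≤ P) (hz : ‖z‖ ≤ Z) : ‖r * (p - q) * z‖ ≤ A * (2 * P) * Z := by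
  have hA := (norm_nonneg r).trans hr
  have hP := (norm_nonneg p).trans hp
  have hpq : ‖p - q‖ ≤ 2 * P := (norm_sub_le _ _).trans (by linarith)
  rw [norm_mul, norm_mul]
  gcongr

theorem norm_sub_mul_le {p q z : ℂ} {P Z : ℝ} (hp : ‖p‖ ≤ P)
    (hq : ‖q‖ ≤ P) (hz : ‖z‖ ≤ Z) : ‖(p - q) * z‖ ≤ 2 * P * Z := by
  have hP := (norm_nonneg p).trans hp
  have hpq : ‖p - q‖ ≤ 2 * P := (norm_sub_le _ _).trans (by linarith)
  rw [norm_mul]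
  gcongr

theorem norm_cexp_mul_le {m : ℂ} {B : ℝ} (hB : 0 ≤ B) (hm : m.re ≤ B) {x : ℝ}
    (hx : x ∈ Icc (0 : ℝ) 1) : ‖Complex.exp (m * x)‖ ≤ Real.exp B := by
  rw [Complex.norm_exp, Complex.re_mul_ofReal]
  refine Real.exp_le_exp.mpr ?_
  nlinarith [hx.1, hx.2]

theorem norm_cexp_le {m : ℂ} {B : ℝ} (hm : m.re ≤ B) : ‖Complex.exp m‖ ≤ Real.exp B := by
  rw [Complex.norm_exp]; exact Real.exp_le_exp.mpr hm

theorem norm_xi_coeff_le {lam m : ℂ} (h1 : 1 ≤ ‖lam‖) {M R : ℝ} (hm : ‖m‖ ≤ M)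
    (hR : ‖lam‖ ≤ R) : ‖(m ^ 2 + -lam) / -lam‖ ≤ M ^ 2 + R := by
  rw [norm_div, norm_neg]
  refine (div_le_self (norm_nonneg _) h1).trans ((norm_add_le _ _).trans ?_)
  rw [norm_neg, norm_pow]
  gcongr

/-- Uniform bounds for eigenvalues in a bounded set. -/
theorem exists_bound_of_norm_le (R : ℝ) : ∃ K : ℝ, 0 < K ∧
    ∀ lam m₁ m₂ m₃ : ℂ, IsCharRoots lam m₁ m₂ m₃ → 1 ≤ ‖lam‖ → ‖lam‖ ≤ R →
      ∀ x ∈ Icc (0 : ℝ) 1, ‖xiFun lam m₁ m₂ m₃ x‖ ≤ K ∧ ‖etaFun m₁ m₂ m₃ x‖ ≤ K := by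
  set M := 3 * |R| + 3 with hM
  have hM0 : 0 < M := by positivity
  have hA : 0 < M ^ 2 + |R| := by positivity
  set E := Real.exp M with hE
  have hE0 : 0 < E := Real.exp_pos M
  refine ⟨6 * (M ^ 2 + |R|) * E * E + 6 * E * E, by positivity, ?_⟩
  intro lam m₁ m₂ m₃ h h1 hR x hx
  replace hR := hR.trans (le_abs_self R)
  have hb : ∀ m : ℂ, m ^ 3 - lam * m ^ 2 - 2 * lam * m + lam ^ 2 = 0 → ‖m‖ ≤ M := by
    intro m hm
    have := norm_root_le hm
    linarith
  have b1 := hb _ h.eval_fst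
  have b2 := hb _ h.rotate.eval_fst
  have b3 := hb _ h.rotate.rotate.eval_fst
  have r1 := (Complex.re_le_norm m₁).trans b1
  have r2 := (Complex.re_le_norm m₂).trans b2
  have r3 := (Complex.re_le_norm m₃).trans b3
  have c1 := norm_xi_coeff_le h1 b1 hR
  have c2 := norm_xi_coeff_le h1 b2 hR
  have c3 := norm_xi_coeff_le h1 b3 hR
  have e1 := norm_cexp_le r1
  have e2 := norm_cexp_le r2
  have e3 := norm_cexp_le r3
  have x1 := norm_cexp_mul_le hM0.le r1 hx
  have x2 := norm_cexp_mul_le hM0.le r2 hx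
  have x3 := norm_cexp_mul_le hM0.le r3 hx
  rw [← hE] at *
  have p1 : 0 < (M ^ 2 + |R|) * E * E := by positivity
  have p2 : 0 < E * E := by positivity
  constructor
  · refine norm_add₃_le.trans ?_
    linarith [norm_mul_sub_mul_le c1 e2 e3 x1, norm_mul_sub_mul_le c2 e3 e1 x2,
      norm_mul_sub_mul_le c3 e1 e2 x3]
  · refine norm_add₃_le.trans ?_
    linarith [norm_sub_mul_le e2 e3 x1, norm_sub_mul_le e3 e1 x2, norm_sub_mul_le e1 e2 x3]

/-! ### Estimates for large eigenvalues. -/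

theorem RootsSplit.norm_coeff_fst_le {lam m₁ m₂ m₃ : ℂ} (h : RootsSplit lam m₁ m₂ m₃)
    (hlam : 10000 ≤ ‖lam‖) : ‖(m₁ ^ 2 + -lam) / -lam‖ ≤ 3 * ‖lam‖ := by
  have h1 : ‖m₁‖ ≤ ‖lam‖ + 7 := by
    have := norm_sub_norm_le m₁ lam
    linarith [h.fst]
  have hr : 0 < ‖lam‖ := by linarith
  rw [norm_div, norm_neg, div_le_iff₀ hr]
  refine (norm_add_le _ _).trans ?_
  rw [norm_neg, norm_pow]
  have : ‖m₁‖ ^ 2 ≤ (‖lam‖ + 7) ^ 2 := by gcongr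
  nlinarith

/-- Near a square root of `lam` the numerator `m² - lam` is itself small: the cubic rewrites it as
`m (m² - 2 lam) / lam`, which is O(√‖lam‖). -/
theorem norm_coeff_snd_le {lam m : ℂ} (hlam : lam ≠ 0)
    (hm : m ^ 3 - lam * m ^ 2 - 2 * lam * m + lam ^ 2 = 0) (h : ‖m‖ ≤ 2 * √‖lam‖) :
    ‖(m ^ 2 + -lam) / -lam‖ ≤ 12 / √‖lam‖ := by
  have e : (m ^ 2 + -lam) / -lam = -m * (m ^ 2 - 2 * lam) / lam ^ 2 := by
    field_simp
    linear_combination hm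
  have hr : 0 < ‖lam‖ := norm_pos_iff.mpr hlam
  have hs : 0 < √‖lam‖ := Real.sqrt_pos.mpr hr
  have hsq : √‖lam‖ ^ 2 = ‖lam‖ := Real.sq_sqrt hr.le
  have h2 : ‖m ^ 2 - 2 * lam‖ ≤ 6 * √‖lam‖ ^ 2 := by
    refine (norm_sub_le _ _).trans ?_
    rw [norm_pow, norm_mul, Complex.norm_ofNat]
    have : ‖m‖ ^ 2 ≤ (2 * √‖lam‖) ^ 2 := by gcongr
    nlinarith
  rw [e, norm_div, norm_mul, norm_neg, norm_pow, div_le_div_iff₀ (by positivity) hs]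
  calc ‖m‖ * ‖m ^ 2 - 2 * lam‖ * √‖lam‖ ≤ 2 * √‖lam‖ * (6 * √‖lam‖ ^ 2) * √‖lam‖ := by gcongr
    _ = 12 * (√‖lam‖ ^ 2) ^ 2 := by ring
    _ = 12 * ‖lam‖ ^ 2 := by rw [hsq]

/-- The eigenvalue condition makes the two slow exponentials nearly equal at `x = 1`. -/
theorem RootsSplit.norm_exp_sub_exp_le {lam m₁ m₂ m₃ : ℂ} (h : RootsSplit lam m₁ m₂ m₃)
    (hlam : 10000 ≤ ‖lam‖)
    (hc : m₁ ^ 2 * (1 - Complex.exp m₁) * (Complex.exp m₂ - Complex.exp m₃) +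
      m₂ ^ 2 * (1 - Complex.exp m₂) * (Complex.exp m₃ - Complex.exp m₁) +
      m₃ ^ 2 * (1 - Complex.exp m₃) * (Complex.exp m₁ - Complex.exp m₂) = 0)
    {E : ℝ} (hE : 1 ≤ E) (hm₁ : m₁.re ≤ -‖lam‖ / 2) (h2 : ‖Complex.exp m₂‖ ≤ E)
    (h3 : ‖Complex.exp m₃‖ ≤ E) :
    ‖Complex.exp m₂ - Complex.exp m₃‖ ≤ 128 * E ^ 2 / ‖lam‖ := by
  have hr : 0 < ‖lam‖ := by linarith
  have hsq : √‖lam‖ ^ 2 = ‖lam‖ := Real.sq_sqrt hr.le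
  have e1 : ‖Complex.exp m₁‖ ≤ 1 / 2 := by
    refine (norm_cexp_le hm₁).trans ?_
    have := Real.add_one_le_exp (‖lam‖ / 2)
    rw [neg_div, Real.exp_neg, inv_le_comm₀ (Real.exp_pos _) (by norm_num)]
    linarith
  have hlow : ‖lam‖ ^ 2 / 4 ≤ ‖m₁ ^ 2 * (1 - Complex.exp m₁)‖ := by
    have a : 9 / 10 * ‖lam‖ ≤ ‖m₁‖ := by
      have := norm_sub_norm_le lam m₁
      rw [norm_sub_rev] at this
      linarith [h.fst]
    have b : 1 / 2 ≤ ‖1 - Complex.exp m₁‖ := by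
      have := norm_sub_norm_le 1 (Complex.exp m₁)
      rw [norm_one] at this
      linarith
    rw [norm_mul, norm_pow]
    calc ‖lam‖ ^ 2 / 4 ≤ (9 / 10 * ‖lam‖) ^ 2 * (1 / 2) := by nlinarith
      _ ≤ _ := by gcongr
  have term : ∀ m p : ℂ, ‖m‖ ≤ 2 * √‖lam‖ → ‖Complex.exp m‖ ≤ E → ‖p‖ ≤ 2 * E →
      ‖m ^ 2 * (1 - Complex.exp m) * p‖ ≤ 16 * ‖lam‖ * E ^ 2 := by
    intro m p hm hem hp
    have : ‖1 - Complex.exp m‖ ≤ 2 * E := (norm_sub_le _ _).trans (by rw [norm_one]; linarith)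
    rw [norm_mul, norm_mul, norm_pow]
    calc _ ≤ (2 * √‖lam‖) ^ 2 * (2 * E) * (2 * E) := by gcongr
      _ = 16 * √‖lam‖ ^ 2 * E ^ 2 := by ring
      _ = _ := by rw [hsq]
  have t2 := term m₂ (Complex.exp m₃ - Complex.exp m₁) h.snd h2
    ((norm_sub_le _ _).trans (by linarith))
  have t3 := term m₃ (Complex.exp m₁ - Complex.exp m₂) h.thd h3
    ((norm_sub_le _ _).trans (by linarith))
  -- The characteristic equation balances the `m₁²` term, of order `‖lam‖²`, against two terms of
  -- order `‖lam‖`.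
  have main : ‖m₁ ^ 2 * (1 - Complex.exp m₁)‖ * ‖Complex.exp m₂ - Complex.exp m₃‖ ≤
      32 * ‖lam‖ * E ^ 2 := by
    rw [← norm_mul, show m₁ ^ 2 * (1 - Complex.exp m₁) * (Complex.exp m₂ - Complex.exp m₃) =
      -(m₂ ^ 2 * (1 - Complex.exp m₂) * (Complex.exp m₃ - Complex.exp m₁) +
      m₃ ^ 2 * (1 - Complex.exp m₃) * (Complex.exp m₁ - Complex.exp m₂)) by
        linear_combination hc, norm_neg]
    refine (norm_add_le _ _).trans ?_
    linarith
  have main2 := (mul_le_mul_of_nonneg_right hlow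
    (norm_nonneg (Complex.exp m₂ - Complex.exp m₃))).trans main
  rw [le_div_iff₀ hr]
  refine le_of_mul_le_mul_left (a := ‖lam‖ / 4) ?_ (by positivity)
  linarith

/-- `hT` bounds the real part of `√lam`, hence Re m₂, Re m₃ ≤ 17 = 2 + 15, and forces Re `lam` ≤ `8
- ‖lam‖`, so the first mode decays. The constant is 432 = 3·128 + 48: boundary layer plus the two
slow modes. -/
theorem RootsSplit.parabolic_bounds {lam m₁ m₂ m₃ : ℂ} (h : RootsSplit lam m₁ m₂ m₃)
    (hm : IsCharRoots lam m₁ m₂ m₃) (he : IsEigenvalue lam) (hlam : 10000 ≤ ‖lam‖)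
    (hT : √((‖lam‖ + lam.re) / 2) ≤ 2) :
    l2Norm (xiFun lam m₁ m₂ m₃) ≤ ENNReal.ofReal (432 * Real.exp 17 ^ 2 / √‖lam‖) ∧
    ∀ x ∈ Icc (0 : ℝ) 1, ‖etaFun m₁ m₂ m₃ x‖ ≤ 432 * Real.exp 17 ^ 2 := by
  have hr : 0 < ‖lam‖ := by linarith
  have hl0 : lam ≠ 0 := norm_pos_iff.mp hr
  have hs : 0 < √‖lam‖ := Real.sqrt_pos.mpr hr
  have hre : lam.re ≤ 8 - ‖lam‖ := by
    rw [Real.sqrt_le_left (by norm_num)] at hT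
    linarith
  have r1 : m₁.re ≤ -‖lam‖ / 2 := by
    have := (Complex.re_le_norm (m₁ - lam)).trans h.fst
    rw [Complex.sub_re] at this
    linarith
  have r2 : m₂.re ≤ 17 := by linarith [le_abs_self m₂.re, h.re_snd]
  have r3 : m₃.re ≤ 17 := by linarith [le_abs_self m₃.re, h.re_thd]
  have hE1 : 1 ≤ Real.exp 17 := Real.one_le_exp (by norm_num)
  have e1 : ‖Complex.exp m₁‖ ≤ Real.exp 17 := norm_cexp_le (by linarith)
  have e2 := norm_cexp_le r2
  have e3 := norm_cexp_le r3
  have x1 := fun x hx => norm_cexp_mul_le (by norm_num) (by linarith : m₁.re ≤ 17) (x := x) hx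
  have x2 := fun x hx => norm_cexp_mul_le (by norm_num) r2 (x := x) hx
  have x3 := fun x hx => norm_cexp_mul_le (by norm_num) r3 (x := x) hx
  have hδ := h.norm_exp_sub_exp_le hlam (he.characteristic_eq hl0 hm) hE1 r1 e2 e3
  generalize Real.exp 17 = E at *
  have hEE : 0 < E ^ 2 := by positivity
  constructor
  · set a := (m₁ ^ 2 + -lam) / -lam * (Complex.exp m₂ - Complex.exp m₃) with ha
    have hab : ‖a‖ ≤ 384 * E ^ 2 := by
      rw [ha, norm_mul]
      calc _ ≤ 3 * ‖lam‖ * (128 * E ^ 2 / ‖lam‖) := by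
            gcongr; exact h.norm_coeff_fst_le hlam
        _ = _ := by field_simp; norm_num
    have hsplit : xiFun lam m₁ m₂ m₃ = fun x : ℝ => a * Complex.exp (m₁ * x) +
        ((m₂ ^ 2 + -lam) / -lam * (Complex.exp m₃ - Complex.exp m₁) * Complex.exp (m₂ * x) +
        (m₃ ^ 2 + -lam) / -lam * (Complex.exp m₁ - Complex.exp m₂) * Complex.exp (m₃ * x)) := by
      ext x; simp only [xiFun, ha]; ring
    have hf : l2Norm (fun x : ℝ => a * Complex.exp (m₁ * x)) ≤
        ENNReal.ofReal (384 * E ^ 2 / √‖lam‖) := by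
      have : l2Norm (fun x : ℝ => a * Complex.exp (m₁ * x)) =
          ‖a‖ₑ * l2Norm (fun x : ℝ => Complex.exp (m₁ * x)) :=
        eLpNorm_const_smul a (fun x : ℝ => Complex.exp (m₁ * x)) 2 _
      rw [this, ← ofReal_norm]
      calc _ ≤ ENNReal.ofReal (384 * E ^ 2) * ENNReal.ofReal (1 / √‖lam‖) := by
            gcongr
            exact l2Norm_exp_le hr r1
        _ = _ := by rw [← ENNReal.ofReal_mul (by positivity), mul_one_div]
    have c2 := norm_coeff_snd_le hl0 hm.rotate.eval_fst h.snd
    have c3 := norm_coeff_snd_le hl0 hm.rotate.rotate.eval_fst h.thd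
    rw [hsplit]
    refine (l2Norm_add_le (by fun_prop) (by fun_prop)).trans ?_
    refine (add_le_add hf (l2Norm_le_of_forall_norm_le (a := 48 * E ^ 2 / √‖lam‖)
      fun x hx => ?_)).trans_eq ?_
    · refine (norm_add_le _ _).trans ((add_le_add (norm_mul_sub_mul_le c2 e3 e1 (x2 x hx))
        (norm_mul_sub_mul_le c3 e1 e2 (x3 x hx))).trans_eq ?_)
      ring
    · rw [← ENNReal.ofReal_add (by positivity) (by positivity)]
      congr 1; ring
  · intro x hx
    refine norm_add₃_le.trans ?_
    nlinarith [norm_sub_mul_le e2 e3 (x1 x hx), norm_sub_mul_le e3 e1 (x2 x hx),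
      norm_sub_mul_le e1 e2 (x3 x hx)]

theorem RootsSplit.hyperbolic_bounds {lam m₁ m₂ m₃ : ℂ} (h : RootsSplit lam m₁ m₂ m₃)
    (hlam : 10000 ≤ ‖lam‖) (hre : |lam.re| ≤ 3) {T : ℝ}
    (hT : √((‖lam‖ + lam.re) / 2) ≤ T) :
    ∀ x ∈ Icc (0 : ℝ) 1,
      ‖xiFun lam m₁ m₂ m₃ x‖ ≤ 18 * Real.exp 25 * ‖lam‖ * Real.exp T ∧
      ‖etaFun m₁ m₂ m₃ x‖ ≤ 6 * Real.exp 25 * Real.exp T := by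
  intro x hx
  have hr : 0 < ‖lam‖ := by linarith
  have hs := Real.sqrt_nonneg ((‖lam‖ + lam.re) / 2)
  have hT0 : 0 ≤ T := hs.trans hT
  have r1 : m₁.re ≤ 10 := by
    have := (Complex.re_le_norm (m₁ - lam)).trans h.fst
    rw [Complex.sub_re] at this
    linarith [le_abs_self lam.re]
  have r2 : m₂.re ≤ T + 15 := by linarith [le_abs_self m₂.re, h.re_snd]
  have r3 : m₃.re ≤ T + 15 := by linarith [le_abs_self m₃.re, h.re_thd]
  have r23 : m₂.re + m₃.re ≤ 7 := by
    have := (Complex.re_le_norm (m₂ + m₃)).trans h.add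
    rwa [Complex.add_re] at this
  have prod : ∀ p q : ℂ, p.re + x * q.re ≤ T + 25 →
      ‖Complex.exp p * Complex.exp (q * x)‖ ≤ Real.exp 25 * Real.exp T := by
    intro p q hpq
    rw [← Complex.exp_add, Complex.norm_exp, ← Real.exp_add]
    refine Real.exp_le_exp.mpr ?_
    rw [Complex.add_re, Complex.re_mul_ofReal]
    linarith
  have scale : ∀ {t B : ℝ}, 0 ≤ B → t ≤ B → x * t ≤ B := by
    intro t B hB ht
    nlinarith [hx.1, hx.2]
  -- Written as `(1 - x) Re p + x (Re p + Re q)`: near-opposite roots cannot both contribute growth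
  -- T.
  have opp : ∀ p q : ℂ, p.re ≤ T + 15 → p.re + q.re ≤ 7 → p.re + x * q.re ≤ T + 25 := by
    intro p q hp hpq
    nlinarith [hx.1, hx.2]
  set G := Real.exp 25 * Real.exp T with hG
  have hG0 : 0 < G := by positivity
  have diff : ∀ p q z : ℂ, ‖p * z‖ ≤ G → ‖q * z‖ ≤ G → ‖(p - q) * z‖ ≤ 2 * G := by
    intro p q z hp hq
    rw [sub_mul]
    exact (norm_sub_le _ _).trans (by linarith)
  have t1 := diff _ _ _ (prod m₂ m₁ (by linarith [scale (by norm_num) r1]))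
    (prod m₃ m₁ (by linarith [scale (by norm_num) r1]))
  have t2 := diff _ _ _ (prod m₃ m₂ (opp _ _ r3 (by linarith)))
    (prod m₁ m₂ (by linarith [scale (by linarith) r2]))
  have t3 := diff _ _ _ (prod m₁ m₃ (by linarith [scale (by linarith) r3]))
    (prod m₂ m₃ (opp _ _ r2 (by linarith)))
  have coeff : ∀ m : ℂ, ‖m‖ ≤ 2 * √‖lam‖ → ‖(m ^ 2 + -lam) / -lam‖ ≤ 3 * ‖lam‖ := by
    intro m hm
    rw [norm_div, norm_neg, div_le_iff₀ hr]
    refine (norm_add_le _ _).trans ?_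
    rw [norm_neg, norm_pow]
    have : ‖m‖ ^ 2 ≤ (2 * √‖lam‖) ^ 2 := by gcongr
    rw [mul_pow, Real.sq_sqrt hr.le] at this
    nlinarith
  have mulc : ∀ c z : ℂ, ‖c‖ ≤ 3 * ‖lam‖ → ‖z‖ ≤ 2 * G → ‖c * z‖ ≤ 3 * ‖lam‖ * (2 * G) := by
    intro c z hc hz
    rw [norm_mul]; gcongr
  constructor
  · have s1 := mulc _ _ (h.norm_coeff_fst_le hlam) t1
    have s2 := mulc _ _ (coeff _ h.snd) t2
    have s3 := mulc _ _ (coeff _ h.thd) t3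
    simp only [← mul_assoc] at s1 s2 s3
    refine norm_add₃_le.trans ((add_le_add (add_le_add s1 s2) s3).trans_eq ?_)
    rw [hG]; ring
  · refine norm_add₃_le.trans ((add_le_add (add_le_add t1 t2) t3).trans_eq ?_)
    rw [hG]; ring

theorem IsCharRoots.parabolic_bounds {lam m₁ m₂ m₃ : ℂ} (hm : IsCharRoots lam m₁ m₂ m₃)
    (he : IsEigenvalue lam) (hlam : 10000 ≤ ‖lam‖) (hT : √((‖lam‖ + lam.re) / 2) ≤ 2) :
    l2Norm (xiFun lam m₁ m₂ m₃) ≤ ENNReal.ofReal (432 * Real.exp 17 ^ 2 / √‖lam‖) ∧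
    ∀ x ∈ Icc (0 : ℝ) 1, ‖etaFun m₁ m₂ m₃ x‖ ≤ 432 * Real.exp 17 ^ 2 := by
  rcases hm.rootsSplit hlam with h | h | h
  · exact h.parabolic_bounds hm he hlam hT
  · have := h.parabolic_bounds hm.rotate he hlam hT
    rwa [xiFun_rotate, etaFun_rotate] at this
  · have := h.parabolic_bounds hm.rotate.rotate he hlam hT
    rwa [xiFun_rotate, etaFun_rotate, xiFun_rotate, etaFun_rotate] at this

theorem IsCharRoots.hyperbolic_bounds {lam m₁ m₂ m₃ : ℂ} (hm : IsCharRoots lam m₁ m₂ m₃)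
    (hlam : 10000 ≤ ‖lam‖) (hre : |lam.re| ≤ 3) {T : ℝ}
    (hT : √((‖lam‖ + lam.re) / 2) ≤ T) :
    ∀ x ∈ Icc (0 : ℝ) 1,
      ‖xiFun lam m₁ m₂ m₃ x‖ ≤ 18 * Real.exp 25 * ‖lam‖ * Real.exp T ∧
      ‖etaFun m₁ m₂ m₃ x‖ ≤ 6 * Real.exp 25 * Real.exp T := by
  rcases hm.rootsSplit hlam with h | h | h
  · exact h.hyperbolic_bounds hlam hre hT
  · have := h.hyperbolic_bounds hlam hre hT
    rwa [xiFun_rotate, etaFun_rotate] at this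
  · have := h.hyperbolic_bounds hlam hre hT
    rwa [xiFun_rotate, etaFun_rotate, xiFun_rotate, etaFun_rotate] at this

/-! ### The two spectral branches and the uniform constants. -/

theorem IsParabolicEigenvalue.location {k : ℕ} (hk : 1 ≤ k) {lam : ℂ}
    (h : IsParabolicEigenvalue k lam) :
    (k : ℝ) ≤ √‖lam‖ ∧ √((‖lam‖ + lam.re) / 2) ≤ 2 := by
  obtain ⟨-, c, d, hc, hd, rfl⟩ := h
  set τ : ℂ := (k : ℂ) * Real.pi + c + Complex.I * d with hτ
  have hk' : (1 : ℝ) ≤ k := by exact_mod_cast hk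
  constructor
  · rw [norm_neg, norm_pow, Real.sqrt_sq (norm_nonneg _)]
    refine le_trans ?_ (Complex.re_le_norm τ)
    have : τ.re = k * Real.pi + c := by simp [hτ]
    rw [this]
    nlinarith [(abs_le.mp hc).1, Real.pi_gt_three]
  -- `iτ` is a square root of `lam`, with real part `-d`.
  · have hs : (Complex.I * τ) ^ 2 = -τ ^ 2 := by rw [mul_pow, Complex.I_sq]; ring
    rw [← abs_re_of_sq_eq hs]
    have : (Complex.I * τ).re = -d := by simp [hτ]
    rw [this, abs_neg]
    linarith [Real.pi_lt_four]

theorem exists_parabolic_bound : ∃ A : ℝ, 0 < A ∧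
    ∀ (k : ℕ) (lam m₁ m₂ m₃ : ℂ), 1 ≤ k → IsParabolicEigenvalue k lam →
      IsCharRoots lam m₁ m₂ m₃ →
      l2Norm (xiFun lam m₁ m₂ m₃) ≤ ENNReal.ofReal (A * (k : ℝ)⁻¹) ∧
      negSobolevNorm 1 (xiFun lam m₁ m₂ m₃) ≤ ENNReal.ofReal (A * (k : ℝ)⁻¹ * (k : ℝ)⁻¹) ∧
      l2Norm (etaFun m₁ m₂ m₃) ≤ ENNReal.ofReal A := by
  obtain ⟨K, hK, hKb⟩ := exists_bound_of_norm_le 10000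
  have hB : 0 < 432 * Real.exp 17 ^ 2 := by positivity
  generalize hBdef : 432 * Real.exp 17 ^ 2 = B at hB
  refine ⟨2 * B + 10000 * K, by positivity, ?_⟩
  intro k lam m₁ m₂ m₃ hk hp hm
  have hk' : (1 : ℝ) ≤ k := by exact_mod_cast hk
  have hk0 : (0 : ℝ) < k := by linarith
  obtain ⟨hks, hT⟩ := hp.location hk
  have hk2 : (k : ℝ) ^ 2 ≤ ‖lam‖ := by
    have : (k : ℝ) ^ 2 ≤ √‖lam‖ ^ 2 := by gcongr
    rwa [Real.sq_sqrt (norm_nonneg _)] at this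
  have h1 : 1 ≤ ‖lam‖ := by nlinarith
  have hl0 : lam ≠ 0 := norm_pos_iff.mp (by linarith)
  have hcξ := continuous_xiFun lam m₁ m₂ m₃
  rcases le_total 10000 ‖lam‖ with hbig | hsmall
  · obtain ⟨a1, a2⟩ := hm.parabolic_bounds hp.1 hbig hT
    rw [hBdef] at a1 a2
    have a2' := l2Norm_le_of_forall_norm_le a2
    have hs0 : 0 < √‖lam‖ := by linarith
    have hsum : l2Norm (fun x => xiFun lam m₁ m₂ m₃ x / 1 + etaFun m₁ m₂ m₃ x / 1) ≤
        ENNReal.ofReal (2 * B) := by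
      simp only [div_one]
      refine (l2Norm_add_le hcξ (continuous_etaFun _ _ _)).trans ?_
      rw [two_mul, ENNReal.ofReal_add hB.le hB.le]
      refine add_le_add (a1.trans (ENNReal.ofReal_le_ofReal ?_)) a2'
      exact div_le_self hB.le (by linarith)
    have a3 := negSobolevNorm_one_xi_le hl0 hp.1 hm (by positivity) hsum
    simp only [div_one] at a3
    refine ⟨a1.trans (ENNReal.ofReal_le_ofReal ?_), a3.trans (ENNReal.ofReal_le_ofReal ?_),
      a2'.trans (ENNReal.ofReal_le_ofReal (by linarith))⟩
    · rw [div_eq_mul_inv]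
      gcongr
      linarith
    · rw [div_eq_mul_inv, mul_assoc (2 * B + 10000 * K), ← mul_inv, ← pow_two]
      gcongr
      linarith
  · have hb := hKb lam m₁ m₂ m₃ hm h1 hsmall
    have b1 := l2Norm_le_of_forall_norm_le fun x hx => (hb x hx).1
    have b2 := l2Norm_le_of_forall_norm_le fun x hx => (hb x hx).2
    -- Here `k² ≤ ‖lam‖ ≤ 10000`, which is where the coefficient of K comes from.
    have hkK : K ≤ (2 * B + 10000 * K) * (k : ℝ)⁻¹ * (k : ℝ)⁻¹ := by
      rw [← div_eq_mul_inv, ← div_eq_mul_inv, le_div_iff₀ hk0, le_div_iff₀ hk0]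
      nlinarith
    have hkK2 : (2 * B + 10000 * K) * (k : ℝ)⁻¹ * (k : ℝ)⁻¹ ≤ (2 * B + 10000 * K) * (k : ℝ)⁻¹ :=
      mul_le_of_le_one_right (by positivity) (inv_le_one_of_one_le₀ hk')
    exact ⟨b1.trans (ENNReal.ofReal_le_ofReal (hkK.trans hkK2)),
      (negSobolevNorm_le_l2Norm zero_le_one hcξ).trans (b1.trans (ENNReal.ofReal_le_ofReal hkK)),
      b2.trans (ENNReal.ofReal_le_ofReal (by linarith))⟩

theorem IsHyperbolicEigenvalue.location {k : ℤ} (hk : 1 ≤ |k|) {lam : ℂ}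
    (h : IsHyperbolicEigenvalue k lam) :
    |(k : ℝ)| ≤ ‖lam‖ ∧ |lam.re| ≤ 3 ∧ ‖lam‖ ≤ 4 * (|(k : ℝ)| * Real.pi) ∧
      √((‖lam‖ + lam.re) / 2) ≤ √(|(k : ℝ)| * Real.pi) + 2 := by
  obtain ⟨-, a, b, ha, hb, hlam⟩ := h
  have hk' : 1 ≤ |(k : ℝ)| := by exact_mod_cast hk
  have hre : lam.re = -1 - a := by simp [hlam]
  have him : lam.im = -(2 * k * Real.pi + b) := by simp [hlam]
  obtain ⟨a1, a2⟩ := abs_le.mp ha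
  have p3 := Real.pi_gt_three
  have p4 := Real.pi_lt_d2
  have hre3 : |lam.re| ≤ 3 := by rw [hre, abs_le]; constructor <;> linarith
  have habs : |2 * (k : ℝ) * Real.pi| = 2 * |(k : ℝ)| * Real.pi := by
    rw [abs_mul, abs_mul, abs_of_pos Real.pi_pos, abs_two]
  have him_le : |lam.im| ≤ 2 * |(k : ℝ)| * Real.pi + Real.pi / 2 := by
    rw [him, abs_neg]
    exact (abs_add_le _ _).trans (by rw [habs]; linarith)
  have him_ge : 2 * |(k : ℝ)| * Real.pi - Real.pi / 2 ≤ |lam.im| := by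
    rw [him, abs_neg]
    have := abs_sub_abs_le_abs_sub (2 * (k : ℝ) * Real.pi) (-b)
    rw [abs_neg, sub_neg_eq_add, habs] at this
    linarith
  have hn := Complex.norm_le_abs_re_add_abs_im lam
  refine ⟨?_, hre3, ?_, ?_⟩
  · refine le_trans ?_ (him_ge.trans (Complex.abs_im_le_norm lam))
    nlinarith
  · nlinarith
  -- `(‖lam‖ + Re lam)/2 ≤ |k|π + 4`; the leading term is exactly the square of the exponent in
  -- `hypDivisor`.
  · refine Real.sqrt_le_iff.mpr ⟨by positivity, ?_⟩
    have h1 : 0 ≤ |(k : ℝ)| * Real.pi := by positivity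
    have h2 := Real.sqrt_nonneg (|(k : ℝ)| * Real.pi)
    rw [add_sq, Real.sq_sqrt h1]
    linarith [le_abs_self lam.re]

theorem le_norm_hypDivisor (k : ℤ) :
    |(k : ℝ)| * Real.pi * Real.exp (√(|(k : ℝ)| * Real.pi)) ≤ ‖(hypDivisor k : ℂ)‖ := by
  rw [Complex.norm_real, Real.norm_eq_abs, hypDivisor, abs_mul, abs_mul, Real.abs_exp,
    abs_of_pos Real.pi_pos]
  gcongr
  have : 0 ≤ 1 / √|(k : ℝ)| := by positivity
  linarith

theorem exists_hyperbolic_bound : ∃ A : ℝ, 0 < A ∧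
    ∀ (k : ℤ) (lam m₁ m₂ m₃ : ℂ), 1 ≤ |k| → IsHyperbolicEigenvalue k lam →
      IsCharRoots lam m₁ m₂ m₃ →
      l2Norm (fun x => xiFun lam m₁ m₂ m₃ x / (hypDivisor k : ℂ)) ≤ ENNReal.ofReal A ∧
      negSobolevNorm 1 (fun x => xiFun lam m₁ m₂ m₃ x / (hypDivisor k : ℂ)) ≤
        ENNReal.ofReal (A * |(k : ℝ)|⁻¹) ∧
      l2Norm (fun x => etaFun m₁ m₂ m₃ x / (hypDivisor k : ℂ)) ≤
        ENNReal.ofReal (A * |(k : ℝ)|⁻¹) := by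
  obtain ⟨K, hK, hKb⟩ := exists_bound_of_norm_le 10000
  have hB : 0 < 72 * Real.exp 25 * Real.exp 2 := by positivity
  generalize hBdef : 72 * Real.exp 25 * Real.exp 2 = B at hB
  refine ⟨2 * B + 10000 * K, by positivity, ?_⟩
  intro k lam m₁ m₂ m₃ hk hh hm
  have hk' : 1 ≤ |(k : ℝ)| := by exact_mod_cast hk
  have hk0 : 0 < |(k : ℝ)| := by linarith
  obtain ⟨hkl, hre, hlk, hT⟩ := hh.location hk
  have h1 : 1 ≤ ‖lam‖ := by linarith
  have hl0 : lam ≠ 0 := norm_pos_iff.mp (by linarith)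
  have hD := le_norm_hypDivisor k
  set q := |(k : ℝ)| * Real.pi with hq
  have hkq : |(k : ℝ)| ≤ q := by rw [hq]; nlinarith [Real.pi_gt_three]
  have hq0 : 0 < q := by linarith
  have hqe : 0 < q * Real.exp √q := by positivity
  have hD0 : 0 < ‖(hypDivisor k : ℂ)‖ := hqe.trans_le hD
  have hcξ : Continuous fun x => xiFun lam m₁ m₂ m₃ x / (hypDivisor k : ℂ) :=
    (continuous_xiFun lam m₁ m₂ m₃).div_const _
  have hcη : Continuous fun x => etaFun m₁ m₂ m₃ x / (hypDivisor k : ℂ) :=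
    (continuous_etaFun m₁ m₂ m₃).div_const _
  rcases le_total 10000 ‖lam‖ with hbig | hsmall
  · have hb := hm.hyperbolic_bounds hbig hre hT
    have a1 : l2Norm (fun x => xiFun lam m₁ m₂ m₃ x / (hypDivisor k : ℂ)) ≤
        ENNReal.ofReal B := by
      refine l2Norm_le_of_forall_norm_le fun x hx => ?_
      rw [norm_div, div_le_iff₀ hD0]
      refine (hb x hx).1.trans (le_trans ?_ (mul_le_mul_of_nonneg_left hD hB.le))
      rw [← hBdef, Real.exp_add]
      calc _ ≤ 18 * Real.exp 25 * (4 * q) * (Real.exp √q * Real.exp 2) := by gcongr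
        _ = _ := by ring
    have a2 : l2Norm (fun x => etaFun m₁ m₂ m₃ x / (hypDivisor k : ℂ)) ≤
        ENNReal.ofReal (B * |(k : ℝ)|⁻¹) := by
      refine l2Norm_le_of_forall_norm_le fun x hx => ?_
      rw [norm_div, div_le_iff₀ hD0]
      refine (hb x hx).2.trans (le_trans ?_ (mul_le_mul_of_nonneg_left hD (by positivity)))
      rw [← hBdef, Real.exp_add]
      calc _ ≤ 72 * Real.exp 25 * (Real.exp √q * Real.exp 2) * 1 := by
            rw [mul_one]; gcongr; norm_num
        _ ≤ 72 * Real.exp 25 * (Real.exp √q * Real.exp 2) * (|(k : ℝ)|⁻¹ * q) := by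
            gcongr
            rwa [le_inv_mul_iff₀ hk0, mul_one]
        _ = _ := by ring
    have hsum : l2Norm (fun x => xiFun lam m₁ m₂ m₃ x / (hypDivisor k : ℂ) +
        etaFun m₁ m₂ m₃ x / (hypDivisor k : ℂ)) ≤ ENNReal.ofReal (2 * B) := by
      refine (l2Norm_add_le hcξ hcη).trans ?_
      rw [two_mul, ENNReal.ofReal_add hB.le hB.le]
      refine add_le_add a1 (a2.trans (ENNReal.ofReal_le_ofReal ?_))
      exact mul_le_of_le_one_right hB.le (inv_le_one_of_one_le₀ hk')
    have a3 := negSobolevNorm_one_xi_le hl0 hh.1 hm (by positivity) hsum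
    refine ⟨a1.trans (ENNReal.ofReal_le_ofReal (by linarith)),
      a3.trans (ENNReal.ofReal_le_ofReal ?_), a2.trans (ENNReal.ofReal_le_ofReal ?_)⟩
    · rw [div_eq_mul_inv]
      gcongr
      linarith
    · gcongr
      linarith
  · have hb := hKb lam m₁ m₂ m₃ hm h1 hsmall
    have hD1 : 1 ≤ ‖(hypDivisor k : ℂ)‖ := by
      have := Real.one_le_exp (Real.sqrt_nonneg q)
      nlinarith
    have hdiv : ∀ z : ℂ, ‖z‖ ≤ K → ‖z / (hypDivisor k : ℂ)‖ ≤ K := fun z hz => by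
      rw [norm_div]
      exact (div_le_self (norm_nonneg _) hD1).trans hz
    have b1 := l2Norm_le_of_forall_norm_le fun x hx => hdiv _ (hb x hx).1
    have b2 := l2Norm_le_of_forall_norm_le fun x hx => hdiv _ (hb x hx).2
    have hkK : K ≤ (2 * B + 10000 * K) * |(k : ℝ)|⁻¹ := by
      rw [← div_eq_mul_inv, le_div_iff₀ hk0]
      nlinarith
    exact ⟨b1.trans (ENNReal.ofReal_le_ofReal (by linarith)),
      (negSobolevNorm_le_l2Norm zero_le_one hcξ).trans (b1.trans (ENNReal.ofReal_le_ofReal hkK)),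
      b2.trans (ENNReal.ofReal_le_ofReal hkK)⟩

end LinNS

theorem lemma3p4 :
    ∃ C : ℝ, 0 < C ∧
      (∀ (k : ℕ) (lam m₁ m₂ m₃ : ℂ) (ξ η : ℝ → ℂ), 1 ≤ k →
        LinNS.IsParabolicEigenvalue k lam → LinNS.IsCharRoots lam m₁ m₂ m₃ →
        ξ = LinNS.xiFun lam m₁ m₂ m₃ → η = LinNS.etaFun m₁ m₂ m₃ →
          LinNS.l2Norm ξ ≤ ENNReal.ofReal (C * (k : ℝ)⁻¹) ∧
          (∀ s : ℝ, 0 < s → s < 1 →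
            LinNS.negSobolevNorm s ξ ≤ ENNReal.ofReal (C * (k : ℝ) ^ (-s - 1))) ∧
          (∀ s : ℝ, 1 ≤ s →
            LinNS.negSobolevNorm s ξ ≤ ENNReal.ofReal (C * (k : ℝ) ^ (-2 : ℝ))) ∧
          LinNS.l2Norm η ≤ ENNReal.ofReal C) ∧
      (∀ (k : ℤ) (lam m₁ m₂ m₃ : ℂ) (ξ η : ℝ → ℂ), 1 ≤ |k| →
        LinNS.IsHyperbolicEigenvalue k lam → LinNS.IsCharRoots lam m₁ m₂ m₃ →
        ξ = (fun x => LinNS.xiFun lam m₁ m₂ m₃ x / (LinNS.hypDivisor k : ℂ)) →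
        η = (fun x => LinNS.etaFun m₁ m₂ m₃ x / (LinNS.hypDivisor k : ℂ)) →
          LinNS.l2Norm ξ ≤ ENNReal.ofReal C ∧
          (∀ s : ℝ, 0 < s → s < 1 →
            LinNS.negSobolevNorm s ξ ≤ ENNReal.ofReal (C * |(k : ℝ)| ^ (-s))) ∧
          (∀ s : ℝ, 1 ≤ s →
            LinNS.negSobolevNorm s ξ ≤ ENNReal.ofReal (C * |(k : ℝ)|⁻¹)) ∧
          LinNS.l2Norm η ≤ ENNReal.ofReal (C * |(k : ℝ)|⁻¹)) := by
  obtain ⟨A, hA, hpar⟩ := LinNS.exists_parabolic_bound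
  obtain ⟨B, hB, hhyp⟩ := LinNS.exists_hyperbolic_bound
  -- The factor 2 is the interpolation constant.
  refine ⟨2 * (A + B), by positivity, ?_, ?_⟩
  · rintro k lam m₁ m₂ m₃ ξ η hk hp hm rfl rfl
    obtain ⟨h0, h1, h2⟩ := hpar k lam m₁ m₂ m₃ hk hp hm
    have hk0 : (0 : ℝ) < k := by exact_mod_cast hk
    have hc := LinNS.continuous_xiFun lam m₁ m₂ m₃
    refine ⟨h0.trans (ENNReal.ofReal_le_ofReal ?_), fun s hs0 hs1 => ?_, fun s hs => ?_,
      h2.trans (ENNReal.ofReal_le_ofReal (by linarith))⟩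
    · gcongr
      linarith
    · refine (LinNS.negSobolevNorm_interpolation hc (by positivity) hk0 h0 h1 hs0.le hs1.le).trans
        (ENNReal.ofReal_le_ofReal ?_)
      rw [sub_eq_add_neg, Real.rpow_add hk0, Real.rpow_neg_one]
      have : 0 < (k : ℝ) ^ (-s) * (k : ℝ)⁻¹ := by positivity
      nlinarith
    · refine (LinNS.negSobolevNorm_anti hs _).trans (h1.trans (ENNReal.ofReal_le_ofReal ?_))
      rw [show (-2 : ℝ) = -1 + -1 by norm_num, Real.rpow_add hk0, Real.rpow_neg_one, mul_assoc]
      gcongr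
      linarith
  · rintro k lam m₁ m₂ m₃ ξ η hk hh hm rfl rfl
    obtain ⟨h0, h1, h2⟩ := hhyp k lam m₁ m₂ m₃ hk hh hm
    have hk1 : 1 ≤ |(k : ℝ)| := by exact_mod_cast hk
    have hk0 : 0 < |(k : ℝ)| := by linarith
    have hc := (LinNS.continuous_xiFun lam m₁ m₂ m₃).div_const (LinNS.hypDivisor k : ℂ)
    refine ⟨h0.trans (ENNReal.ofReal_le_ofReal (by linarith)), fun s hs0 hs1 => ?_, fun s hs => ?_,
      h2.trans (ENNReal.ofReal_le_ofReal ?_)⟩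
    · refine (LinNS.negSobolevNorm_interpolation hc hB.le hk0 h0 h1 hs0.le hs1.le).trans
        (ENNReal.ofReal_le_ofReal ?_)
      gcongr
      linarith
    · refine (LinNS.negSobolevNorm_anti hs _).trans (h1.trans (ENNReal.ofReal_le_ofReal ?_))
      gcongr
      linarith
    · gcongr
      linarith
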